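/- **Coefficient functions.** A coefficient function is a sequence $\mu=(\mu_1,\mu_2,\dots)$ of non-negative integers. For $n\ge1$ put $\mathrm{rev}_n(\mu)=(\mu_n,\dots,\mu_1,0,0,\dots)$. Write $\epsilon<_d\epsilon'$ if at the smallest index where they differ $\epsilon$ is smaller, and, for finitely supported functions, $\mu<_a\mu'$ if at the largest index where they differ $\mu$ is smaller. **Collections.** Let $L=(e_1,\dots,e_N)$ be a list of non-negative integers with $N\ge 2$, $e_1\neq0$, and extend it periodically to all indices $k\geq 1$ by $e_{k+N}=e_k$. *Integers.* For $n\ge1$ let $\theta=\mathrm{rev}_n(e_1,e_2,\dots)$. A proper $L$-block with support interval $[k,n]$ ($1\le k\le n$) is a coefficient function $\zeta$ with $\zeta_j=\theta_j$ for $j>k$, $\zeta_k<\theta_k$ and $\zeta_j=0$ for $j<k$; the maximal $L$-block with support interval $[1,n]$ is $\theta$ itself. Let $\mathcal E$ be the set of sums of finitely many $L$-blocks (proper or maximal) with pairwise disjoint support intervals. For a non-zero finitely supported $\mu$, let $\overline\mu$ be the immediate successor in $(\mathcal E,<_a)$ of the largest member of $\mathcal E$ that is $<_a\mu$. *Unit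 interval.* For $n\ge1$ let $\bar\beta^n=(0,\dots,0,e_1,e_2,\dots)$ with $n-1$ leading zeros. A proper $L^*$-block with support interval $[n,k]$ ($n\le k$) is a coefficient function $\zeta$ with $\zeta_j=\bar\beta^n_j$ for $j<k$, $\zeta_k<\bar\beta^n_k$ and $\zeta_j=0$ for $j>k$. Let $\mathcal E^*$ be the set of non-zero finite or infinite sums of proper $L^*$-blocks with pairwise disjoint support intervals. Let $\overline{\mathcal E^*}$ be the union of $\mathcal E^*$ and the set of all $\sum_{m=1}^{\ell}\zeta^m+\bar\beta^{b+1}$, where $\zeta^1,\dots,\zeta^\ell$ ($0\le\ell<\infty$) are proper $L^*$-blocks with pairwise disjoint support intervals contained in $[1,b]$, one of which ends at $b$ (with $b=0$ if $\ell=0$). Let $\omega$ be the only positive zero of $-1+\sum_{k=1}^{N-1}e_kx^k+(1+e_N)x^N$, and put $Q_n=\omega^n$. **Two lists.** Let $\widetilde L$ be a second list of the same kind (length at least $2$, first entry non-zero), with corresponding $\widetilde{\mathcal E},\widetilde{\mathcal E}^*,\widetilde\omega,\widetilde Q$, and suppose $\mathcal E\subsetneq\widetilde{\mathcal E}$. Let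 $\gamma=\log_{1/\widetilde\omega}(1/\omega)$ and $\mathrm{eval}_{\widetilde Q}(\epsilon)=\sum_k\epsilon_k\widetilde Q_k$; this map is a bijection $\widetilde{\mathcal E}^*\to(0,1)$. For $\epsilon\in\widetilde{\mathcal E}^*$ put $\overline{\mathrm{rev}}(\epsilon)=\bar\beta^1$ if $\bar\beta^1\le_d\epsilon$, and otherwise $\overline{\mathrm{rev}}(\epsilon)=\lim_{n\to\infty}\mathrm{rev}_n\bigl(\overline{\mathrm{rev}_n(\epsilon)}\bigr)$ (entrywise limit). Define $\delta_1^*$ on $[\widetilde\omega,1)$ by $$\delta_1^*\Bigl(\sum_k\epsilon_k\widetilde Q_k\Bigr)=\frac{\sum_k\overline{\mathrm{rev}}(\epsilon)_kQ_k}{\bigl(\sum_k\epsilon_k\widetilde Q_k\bigr)^\gamma}\qquad(\epsilon\in\widetilde{\mathcal E}^*),$$ and $\delta^*:(0,1)\to\mathbb R$ by $\delta^*(y)=\delta_1^*(y/\widetilde\omega^{\,n-1})$, where $n\ge1$ is the integer with $y\in[\widetilde\omega^{\,n},\widetilde\omega^{\,n-1})$. **Theorem.** 1. For every $\epsilon\in\overline{\mathcal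 E^*}$ the number $\mathrm{eval}_{\widetilde Q}(\epsilon)$ lies in $(0,1)$, and $\delta^*$ is not differentiable there. 2. The set of points of $(0,1)$ at which $\delta^*$ is differentiable is $(0,1)\setminus\mathrm{eval}_{\widetilde Q}(\overline{\mathcal E^*})$. 3. If $\overline{\mathcal E^*}\subseteq\widetilde{\mathcal E}^*$, this set is $U=\mathrm{eval}_{\widetilde Q}(\widetilde{\mathcal E}^*\setminus\overline{\mathcal E^*})$. -/

import Mathlib

open Set Filter

namespace GenZeck

/-- Coefficient functions.  All indices are shifted by one: the entry `μ k` is the entry of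
index `k + 1` in the usual notation `(μ₁, μ₂, …)`. -/
abbrev Coeff : Type := ℕ → ℕ

/-- The periodic coefficient function `(e₁, …, e_N, e₁, …, e_N, …)` of a list `(e₁, …, e_N)`. -/
def periodic (L : List ℕ) : Coeff := fun k => L.getD (k % L.length) 0

/-- The reversal `rev_n(μ) = (μ_n, μ_{n-1}, …, μ_1, 0, 0, …)`. -/
def rev (n : ℕ) (μ : Coeff) : Coeff := fun k => if k < n then μ (n - 1 - k) else 0

/-- Ascending lexicographical order. -/
def AscLt (μ ν : Coeff) : Prop := ∃ k, (∀ j, k < j → μ j = ν j) ∧ μ k < ν k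

/-- Descending lexicographical order. -/
def DescLt (μ ν : Coeff) : Prop := ∃ k, (∀ j, j < k → μ j = ν j) ∧ μ k < ν k

/-! ### Collections for positive integers -/

/-- `ζ` is a proper `L`-block with entries on the `n - k` positions of `Ico k n`. -/
def IsProperBlock (L : List ℕ) (k n : ℕ) (ζ : Coeff) : Prop :=
  k < n ∧ (∀ j, k < j → ζ j = rev n (periodic L) j) ∧ ζ k < rev n (periodic L) k ∧
    ∀ j, j < k → ζ j = 0

/-- `ζ` is an `L`-block (proper or maximal) with support interval `Ico k n`. -/
def IsBlock (L : List ℕ) (k n : ℕ) (ζ : Coeff) : Prop :=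
  IsProperBlock L k n ζ ∨ (k = 0 ∧ 0 < n ∧ ζ = rev n (periodic L))

/-- The periodic Zeckendorf collection for positive integers determined by `L`:
the sums of finitely many disjoint `L`-blocks. -/
def collection (L : List ℕ) : Set Coeff :=
  {μ | ∃ (s : ℕ) (ζ : Fin s → Coeff) (a b : Fin s → ℕ),
    (∀ i, IsBlock L (a i) (b i) (ζ i)) ∧
    Pairwise (fun i j => Disjoint (Ico (a i) (b i)) (Ico (a j) (b j))) ∧
    μ = ∑ i, ζ i}

/-- The largest member of `E` that is smaller than `μ` in the ascending order. -/
noncomputable def pred (E : Set Coeff) (μ : Coeff) : Coeff :=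
  Classical.epsilon fun ν => ν ∈ E ∧ AscLt ν μ ∧ ∀ ξ ∈ E, AscLt ξ μ → ξ = ν ∨ AscLt ξ ν

/-- The immediate successor of `μ` in `E`: the smallest member of `E` that is greater than `μ`
in the ascending order. -/
noncomputable def succ (E : Set Coeff) (μ : Coeff) : Coeff :=
  Classical.epsilon fun ν => ν ∈ E ∧ AscLt μ ν ∧ ∀ ξ ∈ E, AscLt μ ξ → ξ = ν ∨ AscLt ν ξ

/-- `μ ↦ μ̄`: the immediate successor in `E` of the largest member of `E` below `μ`. -/
noncomputable def bar (E : Set Coeff) (μ : Coeff) : Coeff := succ E (pred E μ)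

/-! ### Collections for the unit interval -/

/-- The maximal `L*`-block starting at position `n`: `n` zeros, then `e₁, e₂, …` periodically. -/
def maxStar (L : List ℕ) (n : ℕ) : Coeff := fun k => if n ≤ k then periodic L (k - n) else 0

/-- `ζ` is a proper `L*`-block with support interval `Icc n k`. -/
def IsProperStarBlock (L : List ℕ) (n k : ℕ) (ζ : Coeff) : Prop :=
  n ≤ k ∧ (∀ j, j < k → ζ j = maxStar L n j) ∧ ζ k < maxStar L n k ∧ ∀ j, k < j → ζ j = 0

/-- The periodic Zeckendorf collection for `(0,1)` determined by `L`: the non-zero coefficient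
functions that are finite or infinite sums of disjoint proper `L*`-blocks. -/
def starCollection (L : List ℕ) : Set Coeff :=
  {ε | ε ≠ 0 ∧ ∃ (I : Set ℕ) (ζ : ℕ → Coeff) (a c : ℕ → ℕ),
    (∀ i ∈ I, IsProperStarBlock L (a i) (c i) (ζ i)) ∧
    I.PairwiseDisjoint (fun i => Icc (a i) (c i)) ∧
    ∀ k, ε k = ∑ᶠ i ∈ I, ζ i k}

/-- The starred collection together with the sums of finitely many disjoint proper `L*`-blocks
and a maximal `L*`-block that starts right after the last of them (or at the very beginning,
if there are none). -/
def starClosure (L : List ℕ) : Set Coeff :=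
  starCollection L ∪
  {ε | ∃ (s : ℕ) (ζ : Fin s → Coeff) (a c : Fin s → ℕ) (b : ℕ),
    (∀ i, IsProperStarBlock L (a i) (c i) (ζ i) ∧ c i < b) ∧
    Pairwise (fun i j => Disjoint (Icc (a i) (c i)) (Icc (a j) (c j))) ∧
    ((s = 0 ∧ b = 0) ∨ ∃ i, c i + 1 = b) ∧
    ε = (∑ i, ζ i) + maxStar L b}

/-- The characteristic polynomial of `L` for `(0,1)`,
`-1 + ∑_{k<N} e_k x^k + (1 + e_N) x^N`. -/
noncomputable def charFun (L : List ℕ) (x : ℝ) : ℝ :=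
  -1 + ∑ k ∈ Finset.range L.length, (periodic L k : ℝ) * x ^ (k + 1) + x ^ L.length

/-- The only positive real zero of the characteristic polynomial; see `omega_unique`. -/
noncomputable def omega (L : List ℕ) : ℝ := sSup {x : ℝ | 0 < x ∧ charFun L x = 0}

/-- `∑ ε Q`, where `Q_n = w ^ n` for `n = 1, 2, …`. -/
noncomputable def eval (w : ℝ) (ε : Coeff) : ℝ := ∑' k, (ε k : ℝ) * w ^ (k + 1)

theorem charFun_strictMonoOn (L : List ℕ) (hN : 2 ≤ L.length) :
    StrictMonoOn (charFun L) (Ici 0) := by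
  intro x hx y hy hxy
  have hx0 : (0 : ℝ) ≤ x := hx
  have h1 : ∑ k ∈ Finset.range L.length, (periodic L k : ℝ) * x ^ (k + 1)
      ≤ ∑ k ∈ Finset.range L.length, (periodic L k : ℝ) * y ^ (k + 1) := by
    gcongr
  have h2 : x ^ L.length < y ^ L.length := pow_lt_pow_left₀ hxy hx0 (by omega)
  unfold charFun
  linarith

theorem exists_charFun_eq_zero (L : List ℕ) (hN : 2 ≤ L.length) (h1 : 0 < periodic L 0) :
    ∃ x : ℝ, 0 < x ∧ x < 1 ∧ charFun L x = 0 := by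
  have hc : ContinuousOn (charFun L) (Icc 0 1) := by
    unfold charFun
    fun_prop
  have h0 : charFun L 0 = -1 := by
    have : L.length ≠ 0 := by omega
    simp [charFun, this]
  have hone : 0 < charFun L 1 := by
    have h : (periodic L 0 : ℝ) ≤ ∑ k ∈ Finset.range L.length, (periodic L k : ℝ) :=
      Finset.single_le_sum (f := fun k => (periodic L k : ℝ)) (fun _ _ => Nat.cast_nonneg _)
        (Finset.mem_range.2 (by omega))
    have h' : (1 : ℝ) ≤ periodic L 0 := by exact_mod_cast h1
    simp only [charFun, one_pow, mul_one]
    linarith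
  obtain ⟨x, hx, hx'⟩ := intermediate_value_Ioo zero_le_one hc
    (show (0 : ℝ) ∈ Ioo (charFun L 0) (charFun L 1) from ⟨by rw [h0]; norm_num, hone⟩)
  exact ⟨x, hx.1, hx.2, hx'⟩

theorem omega_unique (L : List ℕ) (hN : 2 ≤ L.length) {x : ℝ}
    (hx : 0 < x) (hx' : charFun L x = 0) : omega L = x := by
  have : {x : ℝ | 0 < x ∧ charFun L x = 0} = {x} := by
    ext y
    constructor
    · rintro ⟨hy, hy'⟩
      exact (charFun_strictMonoOn L hN).injOn hy.le hx.le (hy'.trans hx'.symm)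
    · rintro rfl
      exact ⟨hx, hx'⟩
  rw [omega, this, csSup_singleton]

/-! ### The function `δ*` -/

/-- The exponent `γ = log_φ' φ`, where `φ = 1/ω` and `φ' = 1/ω'` belong to `L` and `L'`. -/
noncomputable def gamma (L L' : List ℕ) : ℝ := Real.logb (omega L')⁻¹ (omega L)⁻¹

open Classical in
/-- The maximal `L*`-block `β̄¹` if `β̄¹ ≤ ε` in the descending order; otherwise the entrywise
limit of `rev_n (bar (rev_n ε))`, where the bar is taken in the collection determined by `L`. -/
noncomputable def revBar (L : List ℕ) (ε : Coeff) : Coeff :=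
  if maxStar L 0 = ε ∨ DescLt (maxStar L 0) ε then maxStar L 0
  else limUnder atTop (fun n : ℕ => rev n (bar (collection L) (rev n ε)))

open Classical in
/-- `δ₁*(y) = (∑ revBar(ε) Q) / y ^ γ`, where `ε` is the expansion of `y` in the starred collection
determined by `L'`. -/
noncomputable def deltaOne (L L' : List ℕ) (y : ℝ) : ℝ :=
  if h : ∃ ε ∈ starCollection L', eval (omega L') ε = y then
    eval (omega L) (revBar L h.choose) / y ^ gamma L L'
  else 0

open Classical in
/-- `δ*(y) = δ₁*(y / ω' ^ (n - 1))`, where `n ≥ 1` and `y ∈ [ω' ^ n, ω' ^ (n - 1))`;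
only the values at `y ∈ (0,1)` matter. -/
noncomputable def deltaStar (L L' : List ℕ) (y : ℝ) : ℝ :=
  if h : ∃ n : ℕ, 1 ≤ n ∧ y ∈ Ico (omega L' ^ n) (omega L' ^ (n - 1)) then
    deltaOne L L' (y / omega L' ^ (h.choose - 1))
  else 0

/-- The set `U`: the values of the members of the starred collection of `L'` that are not in the
closure of the starred collection of `L`. -/
def U (L L' : List ℕ) : Set ℝ :=
  eval (omega L') '' (starCollection L' \ starClosure L)

end GenZeck

namespace GenZeck

/-! ### The descending lexicographical order -/

/-! Read a coefficient function from left to right against the digit bound `b = periodic L`,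
counting the digits of `b` currently matched; a smaller digit resets the count. A sequence is
accepted (`Adm b 0`) if no digit exceeds the digit it is compared to. Every proper star block ends
at a reset. Hence `starCollection L` consists of the non-zero accepted sequences with infinitely
many resets, `starClosure L` of all non-zero accepted ones (`mem_starCollection_iff`,
`mem_starClosure_iff`), and `collection L` of the reversed initial segments of accepted sequences
(`rev_mem_collection`, `rev_mem_Adm`). So the inclusion of the collections becomes an inclusion of
the accepted sets, and its strictness gives `omega L' < omega L`.

Write `w = omega L`, `w' = omega L'` and `g y = δ*(y) y ^ γ`. By `revBar_spec`, `revBar L ε` is the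
smallest `L`-accepted sequence that is at least `ε`, or the maximal one. Since `w' ^ γ = w`,
rescaling is compatible with shifts, and `g` sends `eval w' α` to `eval w α` for every non-zero
`L`-accepted `α`. The delicate point is that a number may have two accepted expansions; it never has
three (`eval_lt_of_descLt_of_descLt`), which suffices in `eval_revBar_eq`.

At such a value `g` is not differentiable: some accepted sequence agrees with `α` in `n` digits, but
its `w`-value is at least `c w ^ n` away, while its `w'`-value is within `D w' ^ n`. As `w' < w`,
difference quotients are unbounded (`exists_near`). The remaining points form an open set because
the accepted set is compact. Locally there `revBar` does not change, so `g` is locally constant and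
`δ*` is locally a constant divided by `y ^ γ`. -/

theorem DescLt.irrefl (ε : Coeff) : ¬ DescLt ε ε := fun ⟨_, _, h⟩ => lt_irrefl _ h

theorem DescLt.trans {ε ζ ξ : Coeff} (h : DescLt ε ζ) (h' : DescLt ζ ξ) : DescLt ε ξ := by
  obtain ⟨k, hk, hlt⟩ := h
  obtain ⟨m, hm, hlt'⟩ := h'
  rcases lt_trichotomy k m with hkm | rfl | hkm
  · exact ⟨k, fun j hj => (hk j hj).trans (hm j (hj.trans hkm)), hm k hkm ▸ hlt⟩
  · exact ⟨k, fun j hj => (hk j hj).trans (hm j hj), hlt.trans hlt'⟩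
  · exact ⟨m, fun j hj => (hk j (hj.trans hkm)).trans (hm j hj), (hk m hkm).symm ▸ hlt'⟩

theorem DescLt.asymm {ε ζ : Coeff} (h : DescLt ε ζ) : ¬ DescLt ζ ε :=
  fun h' => DescLt.irrefl _ (h.trans h')

theorem descLt_trichotomy (ε ζ : Coeff) : DescLt ε ζ ∨ ε = ζ ∨ DescLt ζ ε := by
  classical
  by_cases h : ε = ζ
  · exact Or.inr (Or.inl h)
  have hex : ∃ k, ε k ≠ ζ k := by
    by_contra hcon
    push Not at hcon
    exact h (funext hcon)
  have hmin : ∀ j, j < Nat.find hex → ε j = ζ j := fun j hj => not_not.1 (Nat.find_min hex hj)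
  rcases lt_or_gt_of_ne (Nat.find_spec hex) with hlt | hlt
  · exact Or.inl ⟨_, hmin, hlt⟩
  · exact Or.inr (Or.inr ⟨_, fun j hj => (hmin j hj).symm, hlt⟩)

/-- The reflexive closure of the descending lexicographical order. -/
def DescLe (ε ζ : Coeff) : Prop := ε = ζ ∨ DescLt ε ζ

theorem DescLe.refl (ε : Coeff) : DescLe ε ε := Or.inl rfl

theorem DescLe.trans {ε ζ ξ : Coeff} (h : DescLe ε ζ) (h' : DescLe ζ ξ) : DescLe ε ξ := by
  rcases h with rfl | h
  · exact h'
  · rcases h' with rfl | h'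
    · exact Or.inr h
    · exact Or.inr (h.trans h')

theorem DescLe.antisymm {ε ζ : Coeff} (h : DescLe ε ζ) (h' : DescLe ζ ε) : ε = ζ := by
  rcases h with h | h
  · exact h
  · rcases h' with h' | h'
    · exact h'.symm
    · exact absurd h' h.asymm

theorem not_descLe {ε ζ : Coeff} : ¬ DescLe ε ζ ↔ DescLt ζ ε := by
  constructor
  · intro h
    rcases descLt_trichotomy ε ζ with h' | h' | h'
    · exact absurd (Or.inr h') h
    · exact absurd (Or.inl h') h
    · exact h'
  · rintro h (rfl | h')
    · exact DescLt.irrefl _ h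
    · exact h.asymm h'

theorem not_descLt {ε ζ : Coeff} : ¬ DescLt ε ζ ↔ DescLe ζ ε := by
  rw [← not_descLe, not_not]

/-! ### The matching state and accepted sequences -/

/-- The number of digits of the bound `b` that are currently matched when the digits of `ε` are
read from left to right, starting with `i` matched digits.  A digit that is smaller than the
digit of `b` it is compared to resets the state. -/
def st (b : Coeff) (i : ℕ) (ε : Coeff) : ℕ → ℕ
  | 0 => i
  | n + 1 => if ε n < b (st b i ε n) then 0 else st b i ε n + 1

/-- The sequences no digit of which exceeds the digit of `b` it is compared to, when reading starts
with `i` matched digits. -/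
def Adm (b : Coeff) (i : ℕ) : Set Coeff := {ε | ∀ n, ε n ≤ b (st b i ε n)}

/-- The tail of a sequence. -/
def tl (n : ℕ) (ε : Coeff) : Coeff := fun k => ε (n + k)

/-- The first `n` entries of `ε`, followed by `ζ`. -/
def app (n : ℕ) (ε ζ : Coeff) : Coeff := fun k => if k < n then ε k else ζ (k - n)

variable {b : Coeff} {i n : ℕ} {ε ζ ξ : Coeff}

@[simp] theorem st_zero : st b i ε 0 = i := rfl

theorem st_succ : st b i ε (n + 1) = if ε n < b (st b i ε n) then 0 else st b i ε n + 1 := rfl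

theorem st_congr (h : ∀ k < n, ε k = ζ k) : st b i ε n = st b i ζ n := by
  induction n with
  | zero => rfl
  | succ n ih => rw [st_succ, st_succ, ih fun k hk => h k (by omega), h n (by omega)]

theorem st_tl (k : ℕ) : st b (st b i ε n) (tl n ε) k = st b i ε (n + k) := by
  induction k with
  | zero => rfl
  | succ k ih => rw [st_succ, ih, ← add_assoc, st_succ]; rfl

theorem adm_tl (h : ε ∈ Adm b i) (n : ℕ) : tl n ε ∈ Adm b (st b i ε n) := by
  intro k
  rw [st_tl]
  exact h _

theorem tl_app (n : ℕ) (ε ζ : Coeff) : tl n (app n ε ζ) = ζ := by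
  funext k
  simp [GenZeck.tl, app]

theorem app_of_lt {k : ℕ} (h : k < n) : app n ε ζ k = ε k := if_pos h

theorem st_app_of_le {k : ℕ} (h : k ≤ n) : st b i (app n ε ζ) k = st b i ε k :=
  st_congr fun _ hj => app_of_lt (by omega)

theorem adm_app (hε : ∀ k < n, ε k ≤ b (st b i ε k)) (hζ : ζ ∈ Adm b (st b i ε n)) :
    app n ε ζ ∈ Adm b i := by
  intro k
  rcases lt_or_ge k n with hk | hk
  · rw [app_of_lt hk, st_app_of_le hk.le]
    exact hε k hk
  · obtain ⟨m, rfl⟩ := Nat.exists_eq_add_of_le hk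
    rw [← st_tl, tl_app, st_app_of_le le_rfl]
    simpa [GenZeck.app] using hζ m

theorem zero_mem_Adm (b : Coeff) (i : ℕ) : (0 : Coeff) ∈ Adm b i := fun _ => Nat.zero_le _

theorem st_tl_self (b : Coeff) (i n : ℕ) : st b i (tl i b) n = i + n := by
  induction n with
  | zero => rfl
  | succ n ih => rw [st_succ, ih, if_neg (by simp [tl]), add_assoc]

theorem tl_mem_Adm (b : Coeff) (i : ℕ) : tl i b ∈ Adm b i := fun n => by
  rw [st_tl_self]
  exact le_rfl

theorem tl_zero (ε : Coeff) : tl 0 ε = ε := by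
  funext k
  simp [tl]

theorem self_mem_Adm (b : Coeff) : b ∈ Adm b 0 := by
  simpa [tl_zero] using tl_mem_Adm b 0

theorem st_eq_of_forall_not_lt (h : ∀ k < n, ¬ ε k < b (st b i ε k)) : st b i ε n = i + n := by
  induction n with
  | zero => rfl
  | succ n ih => rw [st_succ, ih fun k hk => h k (by omega), if_neg, add_assoc]
                 rw [← ih fun k hk => h k (by omega)]
                 exact h n (by omega)

/-- An accepted sequence without reset is the maximal one. -/
theorem adm_eq_tl (h : ε ∈ Adm b i) (h' : ∀ k, ¬ ε k < b (st b i ε k)) : ε = tl i b := by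
  funext k
  have := st_eq_of_forall_not_lt (n := k) fun j _ => h' j
  have h1 := h k
  have h2 := h' k
  rw [this] at h1 h2
  exact le_antisymm h1 (not_lt.1 h2)

/-- Before the first difference `ε` follows `b` without a reset, so there the state equals the
position and acceptance bounds the digit by that of `b`. -/
theorem adm_descLe (h : ε ∈ Adm b 0) : DescLe ε b := by
  rw [← not_descLt]
  rintro ⟨k, hk, hlt⟩
  have h1 := h k
  rw [← st_congr hk] at h1
  have h2 := st_tl_self b 0 k
  rw [tl_zero, zero_add] at h2
  rw [h2] at h1
  omega

theorem adm_bounded {B : ℕ} (hB : ∀ k, b k ≤ B) (h : ε ∈ Adm b i) (k : ℕ) : ε k ≤ B :=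
  (h k).trans (hB _)

/-! ### Evaluation -/

/-- The properties of the digit bound `b` and the base `w` used for evaluation. -/
structure IsBase (b : Coeff) (w : ℝ) : Prop where
  pos : 0 < w
  lt_one : w < 1
  bdd : ∃ B, ∀ k, b k ≤ B
  head : 0 < b 0
  eval_self : eval w b = 1
  tail : ∃ c > 0, ∀ i, c ≤ eval w (tl i b)

variable {w : ℝ}

theorem summable_eval (h0 : 0 < w) (h1 : w < 1) {B : ℕ} (hB : ∀ k, ε k ≤ B) :
    Summable fun k => (ε k : ℝ) * w ^ (k + 1) := by
  refine Summable.of_nonneg_of_le (fun k => by positivity) (fun k => ?_)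
    ((summable_geometric_of_lt_one h0.le h1).mul_left ((B : ℝ) * w))
  have : (ε k : ℝ) ≤ B := by exact_mod_cast hB k
  calc (ε k : ℝ) * w ^ (k + 1) ≤ B * w ^ (k + 1) := by gcongr
    _ = B * w * w ^ k := by ring

theorem eval_nonneg (h0 : 0 < w) : 0 ≤ eval w ε := tsum_nonneg fun k => by positivity

theorem eval_zero (w : ℝ) : eval w 0 = 0 := by simp [eval]

theorem eval_le (h0 : 0 < w) (h1 : w < 1) {B : ℕ} (hB : ∀ k, ε k ≤ B) :
    eval w ε ≤ B * w / (1 - w) := by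
  have h := (summable_geometric_of_lt_one h0.le h1).mul_left ((B : ℝ) * w)
  have h2 : ∑' k, (B : ℝ) * w * w ^ k = B * w / (1 - w) := by
    rw [tsum_mul_left, tsum_geometric_of_lt_one h0.le h1]
    rfl
  rw [← h2]
  refine Summable.tsum_le_tsum (fun k => ?_) (summable_eval h0 h1 hB) h
  have : (ε k : ℝ) ≤ B := by exact_mod_cast hB k
  calc (ε k : ℝ) * w ^ (k + 1) ≤ B * w ^ (k + 1) := by gcongr
    _ = B * w * w ^ k := by ring

/-- The value of the first `n` digits. -/
noncomputable def psum (w : ℝ) (ε : Coeff) (n : ℕ) : ℝ :=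
  ∑ k ∈ Finset.range n, (ε k : ℝ) * w ^ (k + 1)

theorem psum_succ : psum w ε (n + 1) = psum w ε n + ε n * w ^ (n + 1) :=
  Finset.sum_range_succ _ _

theorem psum_congr (h : ∀ k < n, ε k = ζ k) : psum w ε n = psum w ζ n :=
  Finset.sum_congr rfl fun k hk => by rw [h k (Finset.mem_range.1 hk)]

theorem eval_split (h0 : 0 < w) (h1 : w < 1) {B : ℕ} (hB : ∀ k, ε k ≤ B) (n : ℕ) :
    eval w ε = psum w ε n + w ^ n * eval w (tl n ε) := by
  have h := (summable_eval h0 h1 hB).sum_add_tsum_nat_add n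
  rw [eval, ← h, psum, eval, ← tsum_mul_left]
  congr 1
  refine tsum_congr fun k => ?_
  simp only [tl]
  rw [add_comm k n]
  ring

theorem eval_pos (h0 : 0 < w) (h1 : w < 1) {B : ℕ} (hB : ∀ k, ε k ≤ B) (hε : ε ≠ 0) :
    0 < eval w ε := by
  obtain ⟨k, hk⟩ := Function.ne_iff.1 hε
  refine (summable_eval h0 h1 hB).tsum_pos (fun k => by positivity) k ?_
  have : 0 < ε k := Nat.pos_of_ne_zero hk
  positivity

/-! ### Extremal values and monotonicity of evaluation. -/

namespace IsBase

variable (H : IsBase b w)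
include H

theorem eval_split (h : ε ∈ Adm b i) (n : ℕ) :
    eval w ε = psum w ε n + w ^ n * eval w (tl n ε) := by
  obtain ⟨B, hB⟩ := H.bdd
  exact GenZeck.eval_split H.pos H.lt_one (adm_bounded hB h) n

theorem summable (h : ε ∈ Adm b i) : Summable fun k => (ε k : ℝ) * w ^ (k + 1) := by
  obtain ⟨B, hB⟩ := H.bdd
  exact summable_eval H.pos H.lt_one (adm_bounded hB h)

theorem eval_tl (i : ℕ) : eval w (tl i b) = w * (b i + eval w (tl (i + 1) b)) := by
  rw [H.eval_split (tl_mem_Adm b i) 1]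
  simp only [psum, Finset.range_one, Finset.sum_singleton]
  have : tl 1 (tl i b) = tl (i + 1) b := by funext k; simp only [tl, add_assoc]
  rw [this]
  simp only [tl]
  simp
  ring

theorem eval_tl_pos (i : ℕ) : 0 < eval w (tl i b) := by
  obtain ⟨c, hc, h⟩ := H.tail
  exact hc.trans_le (h i)

theorem eval_tl_zero : eval w (tl 0 b) = 1 := by rw [tl_zero, H.eval_self]

/-- This is the value read so far plus the best continuation from the current state. Without a reset
it is unchanged. A reset gives up at least one unit `w ^ (n + 1)` in the digit and gains a fresh
maximal tail, worth exactly `w ^ (n + 1)` because `eval w b = 1`. -/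
theorem psum_add_antitone (h : ε ∈ Adm b i) :
    Antitone fun n => psum w ε n + w ^ n * eval w (tl (st b i ε n) b) := by
  refine antitone_nat_of_succ_le fun n => ?_
  have hw := H.pos
  have h1 := H.eval_tl (st b i ε n)
  rw [psum_succ, h1, st_succ]
  have hn := h n
  split_ifs with hlt
  · rw [H.eval_tl_zero]
    have h2 : (ε n : ℝ) + 1 ≤ b (st b i ε n) := by exact_mod_cast hlt
    have h3 := H.eval_tl_pos (st b i ε n + 1)
    have : (ε n + 1) * w ^ (n + 1) ≤
      (b (st b i ε n) + eval w (tl (st b i ε n + 1) b)) * w ^ (n + 1) :=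
      mul_le_mul_of_nonneg_right (by linarith) (by positivity)
    rw [pow_succ] at *
    linarith
  · have h2 : (ε n : ℝ) = b (st b i ε n) := by exact_mod_cast le_antisymm hn (not_lt.1 hlt)
    rw [h2, pow_succ]
    apply le_of_eq
    ring

theorem eval_le_tl (h : ε ∈ Adm b i) : eval w ε ≤ eval w (tl i b) := by
  refine (H.summable h).tsum_le_of_sum_range_le fun n => ?_
  have h1 := H.psum_add_antitone h (Nat.zero_le n)
  have h2 := H.eval_tl_pos (st b i ε n)
  have hw := H.pos
  have h3 : 0 < w ^ n * eval w (tl (st b i ε n) b) := by positivity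
  simp only [psum, Finset.range_zero, Finset.sum_empty, pow_zero, one_mul, zero_add, st_zero] at h1
  linarith

theorem eval_le_one (h : ε ∈ Adm b 0) : eval w ε ≤ 1 := H.eval_tl_zero ▸ H.eval_le_tl h

/-- A reset loses strictly: the abandoned tail of `b` has positive value. -/
theorem eval_lt_tl (h : ε ∈ Adm b i) (hlt : ε n < b (st b i ε n)) :
    eval w ε < eval w (tl i b) := by
  have hw := H.pos
  have h1 := H.psum_add_antitone h (Nat.zero_le n)
  simp only [psum, Finset.range_zero, Finset.sum_empty, pow_zero, one_mul, zero_add, st_zero] at h1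
  have h2 := H.eval_split h (n + 1)
  have h3 := H.eval_le_tl (adm_tl h (n + 1))
  rw [st_succ, if_pos hlt, H.eval_tl_zero] at h3
  have h4 := H.eval_tl (st b i ε n)
  have h5 := H.eval_tl_pos (st b i ε n + 1)
  have h6 : (ε n : ℝ) + 1 ≤ b (st b i ε n) := by exact_mod_cast hlt
  rw [h4] at h1
  have h7 : w ^ (n + 1) * eval w (tl (n + 1) ε) ≤ w ^ (n + 1) * 1 := by gcongr
  have h8 : w ^ (n + 1) * (ε n + 1) <
      w ^ (n + 1) * (b (st b i ε n) + eval w (tl (st b i ε n + 1) b)) :=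
    mul_lt_mul_of_pos_left (by linarith) (by positivity)
  have h9 := psum_succ (w := w) (ε := ε) (n := n)
  simp only [psum] at h9 h2
  rw [pow_succ] at *
  linarith

/-- The value of a sequence that drops below an accepted one at position `k`. -/
theorem eval_le_of_drop {k : ℕ} (hε : ε ∈ Adm b i) (hζ : ζ ∈ Adm b i)
    (hk : ∀ j, j < k → ε j = ζ j) (hlt : ε k < ζ k) :
    eval w ε + (w ^ (k + 1) * (1 - eval w (tl (k + 1) ε)) +
      w ^ (k + 1) * eval w (tl (k + 1) ζ)) ≤ eval w ζ ∧ tl (k + 1) ε ∈ Adm b 0 := by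
  have hw := H.pos
  have h1 : ε k < b (st b i ε k) := by
    rw [st_congr hk]
    exact hlt.trans_le (hζ k)
  have h2 := adm_tl hε (k + 1)
  rw [st_succ, if_pos h1] at h2
  refine ⟨?_, h2⟩
  rw [H.eval_split hε (k + 1), H.eval_split hζ (k + 1), psum_succ, psum_succ, psum_congr hk]
  have h3 : (ε k : ℝ) + 1 ≤ ζ k := by exact_mod_cast hlt
  have h4 : (ε k + 1) * w ^ (k + 1) ≤ ζ k * w ^ (k + 1) := by gcongr
  linarith

theorem eval_mono_of_descLt (hε : ε ∈ Adm b i) (hζ : ζ ∈ Adm b i) (h : DescLt ε ζ) :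
    eval w ε ≤ eval w ζ := by
  obtain ⟨k, hk, hlt⟩ := h
  have hw := H.pos
  obtain ⟨h1, h2⟩ := H.eval_le_of_drop hε hζ hk hlt
  have h3 : 0 ≤ w ^ (k + 1) * (1 - eval w (tl (k + 1) ε)) :=
    mul_nonneg (by positivity) (sub_nonneg.2 (H.eval_le_one h2))
  have h4 : 0 ≤ w ^ (k + 1) * eval w (tl (k + 1) ζ) := mul_nonneg (by positivity) (eval_nonneg hw)
  linarith

theorem eval_mono (hε : ε ∈ Adm b i) (hζ : ζ ∈ Adm b i) (h : DescLe ε ζ) :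
    eval w ε ≤ eval w ζ := by
  rcases h with rfl | h
  · exact le_rfl
  · exact H.eval_mono_of_descLt hε hζ h

theorem descLt_of_eval_lt (hε : ε ∈ Adm b i) (hζ : ζ ∈ Adm b i) (h : eval w ε < eval w ζ) :
    DescLt ε ζ := by
  rw [← not_descLe]
  exact fun h' => absurd (H.eval_mono hζ hε h') (not_le.2 h)

/-- Strict monotonicity if the smaller sequence is reset infinitely often. -/
theorem eval_strictMono (hε : ε ∈ Adm b i) (hζ : ζ ∈ Adm b i)
    (hinf : ∀ m, ∃ n ≥ m, ε n < b (st b i ε n)) (h : DescLt ε ζ) : eval w ε < eval w ζ := by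
  obtain ⟨k, hk, hlt⟩ := h
  have hw := H.pos
  obtain ⟨h1, h2⟩ := H.eval_le_of_drop hε hζ hk hlt
  -- The drop at `k` resets the state; one further reset makes the value of the tail of `ε` strictly
  -- less than `1`.
  obtain ⟨n, hn, hlt'⟩ := hinf (k + 1)
  obtain ⟨m, rfl⟩ := Nat.exists_eq_add_of_le hn
  have hst : st b i ε (k + 1) = 0 := by
    rw [st_succ, if_pos]
    rw [st_congr hk]
    exact hlt.trans_le (hζ k)
  rw [← st_tl, hst] at hlt'
  have h5 := H.eval_lt_tl (n := m) h2 hlt'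
  rw [H.eval_tl_zero] at h5
  have h3 : 0 < w ^ (k + 1) * (1 - eval w (tl (k + 1) ε)) :=
    mul_pos (by positivity) (sub_pos.2 h5)
  have h4 : 0 ≤ w ^ (k + 1) * eval w (tl (k + 1) ζ) := mul_nonneg (by positivity) (eval_nonneg hw)
  linarith

/-- A sequence with only finitely many non-zero entries is reset infinitely often. -/
theorem resets_of_eventually_zero {m : ℕ} (hε : ε ∈ Adm b i) (h : tl m ε = 0) (k : ℕ) :
    ∃ n ≥ k, ε n < b (st b i ε n) := by
  by_contra hcon
  push Not at hcon
  have h1 := adm_tl hε (m + k)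
  have h2 : tl (m + k) ε = tl (st b i ε (m + k)) b := by
    refine adm_eq_tl h1 fun j => ?_
    rw [st_tl]
    exact not_lt.2 (hcon _ (by omega))
  have h3 : tl (m + k) ε = 0 := by
    funext j
    have := congrFun h (k + j)
    simpa [tl, add_assoc] using this
  have h4 := H.eval_tl_pos (st b i ε (m + k))
  rw [← h2, h3, eval_zero] at h4
  exact lt_irrefl _ h4

/-- No three sequences have the same value. -/
theorem eval_lt_of_descLt_of_descLt (hε : ε ∈ Adm b i) (hζ : ζ ∈ Adm b i) (hξ : ξ ∈ Adm b i)
    (h : DescLt ε ζ) (h' : DescLt ζ ξ) : eval w ε < eval w ξ := by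
  have hw := H.pos
  have hle := H.eval_mono_of_descLt hζ hξ h'
  rcases (H.eval_mono_of_descLt hε hζ h).lt_or_eq with hlt | heq
  · exact hlt.trans_le hle
  rw [heq]
  obtain ⟨k, hk, hlt⟩ := h
  obtain ⟨h1, h2⟩ := H.eval_le_of_drop hε hζ hk hlt
  have h3 : 0 ≤ w ^ (k + 1) * (1 - eval w (tl (k + 1) ε)) :=
    mul_nonneg (by positivity) (sub_nonneg.2 (H.eval_le_one h2))
  -- Equal values of `ε` and `ζ` force `ζ` to vanish after the drop. Then `ζ` is reset infinitely
  -- often, so the step from `ζ` to `ξ` is strict.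
  have h4 : w ^ (k + 1) * eval w (tl (k + 1) ζ) ≤ 0 := by linarith
  have h5 : tl (k + 1) ζ = 0 := by
    by_contra hne
    obtain ⟨B, hB⟩ := H.bdd
    have := eval_pos hw H.lt_one (adm_bounded hB (adm_tl hζ (k + 1))) hne
    have : 0 < w ^ (k + 1) * eval w (tl (k + 1) ζ) := by positivity
    linarith
  exact H.eval_strictMono hζ hξ (H.resets_of_eventually_zero hζ h5) h'

end IsBase
end GenZeck

namespace GenZeck
variable {b : Coeff} {i n : ℕ} {ε ζ ξ : Coeff} {w : ℝ}

/-! ### Greedy expansions -/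

/-- The digit chosen by the greedy algorithm in the state `i` with remainder `r`. -/
noncomputable def greedyDigit (b : Coeff) (w : ℝ) (p : ℕ × ℝ) : ℕ := min ⌊p.2 / w⌋₊ (b p.1)

/-- State and remainder of the greedy algorithm. -/
noncomputable def greedyState (b : Coeff) (w v : ℝ) : ℕ → ℕ × ℝ
  | 0 => (0, v)
  | n + 1 =>
    let p := greedyState b w v n
    (if greedyDigit b w p < b p.1 then 0 else p.1 + 1, p.2 / w - greedyDigit b w p)

/-- The greedy expansion of `v`. -/
noncomputable def greedy (b : Coeff) (w v : ℝ) : Coeff :=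
  fun n => greedyDigit b w (greedyState b w v n)

theorem st_greedy (b : Coeff) (w v : ℝ) (n : ℕ) :
    st b 0 (greedy b w v) n = (greedyState b w v n).1 := by
  induction n with
  | zero => rfl
  | succ n ih => rw [st_succ, ih]; rfl

theorem greedy_mem_Adm (b : Coeff) (w v : ℝ) : greedy b w v ∈ Adm b 0 := fun n => by
  rw [st_greedy]
  exact min_le_right _ _

theorem psum_greedy (hw : 0 < w) (v : ℝ) (n : ℕ) :
    psum w (greedy b w v) n + w ^ n * (greedyState b w v n).2 = v := by
  induction n with
  | zero => simp [psum, greedyState]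
  | succ n ih =>
    rw [psum_succ]
    have : (greedyState b w v (n + 1)).2 = (greedyState b w v n).2 / w - greedy b w v n := rfl
    rw [this, mul_sub, pow_succ, mul_assoc (w ^ n) w (_ / w), mul_div_cancel₀ _ hw.ne']
    linarith

namespace IsBase
variable (H : IsBase b w)
include H

/-- The invariant of the greedy algorithm: the remainder stays strictly below the largest value
attainable from the current state. After a reset it is a fractional part, hence below `1`. -/
theorem greedyState_mem {v : ℝ} (h0 : 0 ≤ v) (h1 : v < 1) (n : ℕ) :
    (greedyState b w v n).2 ∈ Ico 0 (eval w (tl (greedyState b w v n).1 b)) := by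
  have hw := H.pos
  induction n with
  | zero => exact ⟨h0, by rw [show (greedyState b w v 0).1 = 0 from rfl, H.eval_tl_zero]; exact h1⟩
  | succ n ih =>
    set p := greedyState b w v n with hp
    have e1 : (greedyState b w v (n + 1)).1 =
      if greedyDigit b w p < b p.1 then 0 else p.1 + 1 := rfl
    have e2 : (greedyState b w v (n + 1)).2 = p.2 / w - greedyDigit b w p := rfl
    have hnn : 0 ≤ p.2 / w := div_nonneg ih.1 hw.le
    have hfl : (greedyDigit b w p : ℝ) ≤ p.2 / w :=
      (Nat.cast_le.2 (min_le_left _ _)).trans (Nat.floor_le hnn)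
    rw [e1, e2]
    refine ⟨sub_nonneg.2 hfl, ?_⟩
    split_ifs with h
    · rw [H.eval_tl_zero]
      have : greedyDigit b w p = ⌊p.2 / w⌋₊ := by
        unfold greedyDigit at h ⊢
        omega
      rw [this]
      linarith [Nat.lt_floor_add_one (p.2 / w)]
    · have h2 : greedyDigit b w p = b p.1 := le_antisymm (min_le_right _ _) (not_lt.1 h)
      have h3 := ih.2
      rw [H.eval_tl, ← div_lt_iff₀' hw] at h3
      rw [h2]
      linarith

theorem eval_greedy {v : ℝ} (h0 : 0 ≤ v) (h1 : v < 1) : eval w (greedy b w v) = v := by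
  have hw := H.pos
  obtain ⟨B, hB⟩ := H.bdd
  have hs := (H.summable (greedy_mem_Adm b w v)).hasSum.tendsto_sum_nat
  refine tendsto_nhds_unique hs ?_
  have h2 : Tendsto (fun n => w ^ n * (greedyState b w v n).2) atTop (nhds 0) := by
    have h3 : Tendsto (fun n => w ^ n * (B * w / (1 - w))) atTop (nhds 0) := by
      simpa using (tendsto_pow_atTop_nhds_zero_of_lt_one hw.le H.lt_one).mul_const
        (B * w / (1 - w))
    refine squeeze_zero (fun n => mul_nonneg (by positivity) (H.greedyState_mem h0 h1 n).1)
      (fun n => ?_) h3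
    refine mul_le_mul_of_nonneg_left ((H.greedyState_mem h0 h1 n).2.le.trans ?_) (by positivity)
    exact eval_le hw H.lt_one fun k => hB _
  have h4 : Tendsto (fun n => v - w ^ n * (greedyState b w v n).2) atTop (nhds v) := by
    simpa using tendsto_const_nhds.sub h2
  refine h4.congr fun n => ?_
  have := psum_greedy (b := b) hw v n
  rw [psum] at this
  linarith

/-- If the resets stopped, the tail would be maximal and the remainder would reach the bound that
`greedyState_mem` keeps strict. -/
theorem resets_greedy {v : ℝ} (h0 : 0 ≤ v) (h1 : v < 1) (m : ℕ) :
    ∃ n ≥ m, greedy b w v n < b (st b 0 (greedy b w v) n) := by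
  by_contra hcon
  push Not at hcon
  have hw := H.pos
  have h2 : tl m (greedy b w v) = tl (st b 0 (greedy b w v) m) b := by
    refine adm_eq_tl (adm_tl (greedy_mem_Adm b w v) m) fun j => ?_
    rw [st_tl]
    exact not_lt.2 (hcon _ (by omega))
  have h3 := H.eval_split (greedy_mem_Adm b w v) m
  rw [H.eval_greedy h0 h1, h2, st_greedy] at h3
  have h4 := (H.greedyState_mem h0 h1 m).2
  have h5 := psum_greedy (b := b) hw v m
  have h6 := mul_lt_mul_of_pos_left h4 (pow_pos hw m)
  linarith

/-- Every number in `[0,1)` is the value of an accepted sequence with infinitely many resets. -/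
theorem exists_eval_eq {v : ℝ} (h0 : 0 ≤ v) (h1 : v < 1) :
    ∃ ε ∈ Adm b 0, (∀ m, ∃ n ≥ m, ε n < b (st b 0 ε n)) ∧ eval w ε = v :=
  ⟨_, greedy_mem_Adm b w v, H.resets_greedy h0 h1, H.eval_greedy h0 h1⟩

end IsBase

/-! ### Compactness -/

theorem continuous_st (b : Coeff) (i n : ℕ) : Continuous fun ε : Coeff => st b i ε n := by
  induction n with
  | zero => exact continuous_const
  | succ n ih =>
    have h : Continuous fun p : ℕ × ℕ => if p.1 < b p.2 then 0 else p.2 + 1 :=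
      continuous_of_discreteTopology
    exact h.comp ((continuous_apply n).prodMk ih)

/-- Each acceptance condition depends on finitely many digits, hence is closed in the product
topology. -/
theorem isClosed_Adm (b : Coeff) (i : ℕ) : IsClosed (Adm b i) := by
  have : Adm b i = ⋂ n, {ε | ε n ≤ b (st b i ε n)} := by
    ext ε
    simp [Adm]
  rw [this]
  refine isClosed_iInter fun n => isClosed_le (continuous_apply n) ?_
  exact (continuous_of_discreteTopology (f := b)).comp (continuous_st b i n)

theorem isCompact_Adm {B : ℕ} (hB : ∀ k, b k ≤ B) (i : ℕ) : IsCompact (Adm b i) := by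
  have h : IsCompact (Set.univ.pi fun _ : ℕ => Set.Iic B) :=
    isCompact_univ_pi fun _ => (Set.finite_Iic B).isCompact
  exact h.of_isClosed_subset (isClosed_Adm b i) fun ε hε k _ => adm_bounded hB hε k

theorem continuousOn_eval (h0 : 0 < w) (h1 : w < 1) {B : ℕ} (hB : ∀ k, b k ≤ B) (i : ℕ) :
    ContinuousOn (eval w) (Adm b i) := by
  refine continuousOn_tsum (u := fun k => B * w * w ^ k) (fun k => ?_)
    ((summable_geometric_of_lt_one h0.le h1).mul_left ((B : ℝ) * w)) (fun k ε hε => ?_)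
  · have : Continuous fun ε : Coeff => (ε k : ℝ) :=
      (continuous_of_discreteTopology (f := fun m : ℕ => (m : ℝ))).comp (continuous_apply k)
    exact (this.mul continuous_const).continuousOn
  · have : (ε k : ℝ) ≤ B := by exact_mod_cast adm_bounded hB hε k
    rw [Real.norm_of_nonneg (by positivity)]
    calc (ε k : ℝ) * w ^ (k + 1) ≤ B * w ^ (k + 1) := by gcongr
      _ = B * w * w ^ k := by ring

theorem isClosed_eval_image (h0 : 0 < w) (h1 : w < 1) {B : ℕ} (hB : ∀ k, b k ≤ B) (i : ℕ) :
    IsClosed (eval w '' Adm b i) :=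
  ((isCompact_Adm hB i).image_of_continuousOn (continuousOn_eval h0 h1 hB i)).isClosed

end GenZeck

namespace GenZeck
variable {b : Coeff} {i n : ℕ} {ε ζ ξ : Coeff} {w : ℝ}

/-! ### Periodic digit bounds -/

theorem periodic_mod (L : List ℕ) (k : ℕ) : periodic L (k % L.length) = periodic L k := by
  simp [periodic]

theorem periodic_add_length (L : List ℕ) (k : ℕ) : periodic L (k + L.length) = periodic L k := by
  simp [periodic]

theorem periodic_zero (L : List ℕ) : periodic L 0 = L.getD 0 0 := by simp [periodic]

theorem periodic_bounded {L : List ℕ} (hL : 2 ≤ L.length) (k : ℕ) :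
    periodic L k ≤ ∑ j ∈ Finset.range L.length, periodic L j := by
  rw [← periodic_mod]
  exact Finset.single_le_sum (f := periodic L) (fun _ _ => Nat.zero_le _)
    (Finset.mem_range.2 (Nat.mod_lt _ (by omega)))

/-- With `N = L.length`, periodicity and the characteristic equation give `V = (1 - x ^ N) + x ^ N
V` for the value `V` of the bound, so `V = 1`. Tails are bounded below because the non-zero first
entry recurs within `N` positions. -/
theorem isBase_periodic {L : List ℕ} (hL : 2 ≤ L.length) (hL0 : L.getD 0 0 ≠ 0) :
    IsBase (periodic L) (omega L) := by
  have hhead : 0 < periodic L 0 := by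
    rw [periodic_zero]
    exact Nat.pos_of_ne_zero hL0
  obtain ⟨x, hx0, hx1, hx⟩ := exists_charFun_eq_zero L hL hhead
  have hB := periodic_bounded hL
  rw [omega_unique L hL hx0 hx]
  have hsum : ∀ i, Summable fun k => (tl i (periodic L) k : ℝ) * x ^ (k + 1) :=
    fun i => summable_eval hx0 hx1 fun k => hB _
  refine ⟨hx0, hx1, ⟨_, hB⟩, hhead, ?_, x ^ L.length, by positivity, fun i => ?_⟩
  · have h1 := eval_split hx0 hx1 hB L.length
    have h2 : tl L.length (periodic L) = periodic L := by
      funext k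
      rw [tl, add_comm, periodic_add_length]
    rw [h2] at h1
    have h3 : psum x (periodic L) L.length = 1 - x ^ L.length := by
      unfold charFun at hx
      unfold psum
      linarith
    have h4 : x ^ L.length < 1 := pow_lt_one₀ hx0.le hx1 (by omega)
    rw [h3] at h1
    have h5 : (1 - x ^ L.length) * (eval x (periodic L) - 1) = 0 := by linarith
    rcases mul_eq_zero.1 h5 with h6 | h6 <;> linarith
  -- `j` is congruent to `-i` modulo `L.length`, so position `i + j` starts a period.
  · set j := i * (L.length - 1) % L.length with hj
    have hjN : j < L.length := Nat.mod_lt _ (by omega)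
    have h1 : tl i (periodic L) j = periodic L 0 := by
      rw [tl, ← periodic_mod, hj, Nat.add_mod_mod]
      have : i + i * (L.length - 1) = i * L.length := by
        obtain ⟨N, hN⟩ := Nat.exists_eq_add_of_le' (show 1 ≤ L.length by omega)
        rw [hN, Nat.add_sub_cancel]
        ring
      rw [this, Nat.mul_mod_left]
    have h2 := (hsum i).le_tsum j fun k _ => by positivity
    have h3 : x ^ L.length ≤ x ^ (j + 1) := pow_le_pow_of_le_one hx0.le hx1.le hjN
    have h4 : (1 : ℝ) ≤ tl i (periodic L) j := by
      rw [h1]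
      exact_mod_cast hhead
    refine le_trans ?_ h2
    calc x ^ L.length ≤ 1 * x ^ (j + 1) := by rw [one_mul]; exact h3
      _ ≤ _ := by gcongr

/-! ### Decomposition into blocks -/

/-- The states along a sequence composed of disjoint blocks. -/
theorem st_of_blocks {ι : Type*} (hb : 0 < b 0) (n : ℕ) (S : ι → Set ℕ) (a : ι → ℕ)
    (h1 : ∀ j, ∀ p ∈ S j, a j ≤ p)
    (h2 : ∀ j, ∀ p ∈ S j, p + 1 < n → p + 1 ∈ S j → ε p = b (p - a j))
    (h2' : ∀ j, ∀ p ∈ S j, p + 1 < n → p + 1 ∉ S j → ε p < b (p - a j))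
    (h3 : ∀ j p, p + 1 ∈ S j → p ∉ S j → a j = p + 1)
    (h4 : ∀ j j' p, p ∈ S j → p ∈ S j' → j = j')
    (h5 : ∀ p < n, (∀ j, p ∉ S j) → ε p = 0) (p : ℕ) (hp : p < n) :
    (∀ j, p ∈ S j → st b 0 ε p = p - a j) ∧ ((∀ j, p ∉ S j) → st b 0 ε p = 0) := by
  induction p with
  | zero => exact ⟨fun j hj => by simp, fun _ => rfl⟩
  | succ p ih =>
    obtain ⟨ih1, ih2⟩ := ih (by omega)
    by_cases hc : ∃ j, p ∈ S j
    · obtain ⟨j, hj⟩ := hc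
      have hst := ih1 j hj
      by_cases hj' : p + 1 ∈ S j
      · have hs : st b 0 ε (p + 1) = p + 1 - a j := by
          rw [st_succ, hst, if_neg (by rw [h2 j p hj hp hj']; exact lt_irrefl _)]
          have := h1 j p hj
          omega
        refine ⟨fun m hm => ?_, fun h => absurd hj' (h j)⟩
        rw [h4 _ _ _ hm hj', hs]
      · have hs : st b 0 ε (p + 1) = 0 := by
          rw [st_succ, hst, if_pos (h2' j p hj hp hj')]
        refine ⟨fun m hm => ?_, fun _ => hs⟩
        have hpm : p ∉ S m := fun h => hj' (h4 _ _ _ h hj ▸ hm)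
        rw [hs, h3 m p hm hpm, Nat.sub_self]
    · push Not at hc
      have hs : st b 0 ε (p + 1) = 0 := by
        rw [st_succ, ih2 hc, h5 p (by omega) hc, if_pos hb]
      refine ⟨fun m hm => ?_, fun _ => hs⟩
      rw [hs, h3 m p hm (hc m), Nat.sub_self]

/-- The state inside a block is the offset from its start, so the block's own digit bound is the
acceptance condition. The abstract supports `S` cover finite and infinite star blocks and reversed
integer blocks alike. No drop is required at position `n - 1`, where a reversed maximal block ends.
-/
theorem le_of_blocks {ι : Type*} (hb : 0 < b 0) (n : ℕ) (S : ι → Set ℕ) (a : ι → ℕ)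
    (h1 : ∀ j, ∀ p ∈ S j, a j ≤ p) (h1' : ∀ j, ∀ p ∈ S j, p < n → ε p ≤ b (p - a j))
    (h2 : ∀ j, ∀ p ∈ S j, p + 1 < n → p + 1 ∈ S j → ε p = b (p - a j))
    (h2' : ∀ j, ∀ p ∈ S j, p + 1 < n → p + 1 ∉ S j → ε p < b (p - a j))
    (h3 : ∀ j p, p + 1 ∈ S j → p ∉ S j → a j = p + 1)
    (h4 : ∀ j j' p, p ∈ S j → p ∈ S j' → j = j')
    (h5 : ∀ p < n, (∀ j, p ∉ S j) → ε p = 0) (p : ℕ) (hp : p < n) :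
    ε p ≤ b (st b 0 ε p) := by
  obtain ⟨h6, h7⟩ := st_of_blocks hb n S a h1 h2 h2' h3 h4 h5 p hp
  by_cases hc : ∃ j, p ∈ S j
  · obtain ⟨j, hj⟩ := hc
    rw [h6 j hj]
    exact h1' j p hj hp
  · push Not at hc
    rw [h5 p hp hc]
    exact Nat.zero_le _

theorem st_le (b : Coeff) (ε : Coeff) (n : ℕ) : st b 0 ε n ≤ n := by
  induction n with
  | zero => exact le_rfl
  | succ n ih =>
    rw [st_succ]
    split_ifs <;> omega

/-- Inside the matched part no reset has occurred. -/
theorem st_matched {k : ℕ} (h : n - st b 0 ε n ≤ k) (hk : k ≤ n) :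
    st b 0 ε k = k - (n - st b 0 ε n) := by
  induction n with
  | zero =>
    obtain rfl : k = 0 := by omega
    rfl
  | succ n ih =>
    rcases hk.eq_or_lt with rfl | hk'
    · have := st_le b ε (n + 1)
      omega
    · rw [st_succ] at h ⊢
      split_ifs at h ⊢ with hlt
      · omega
      · rw [show n + 1 - (st b 0 ε n + 1) = n - st b 0 ε n by omega] at h ⊢
        exact ih h (by omega)

theorem not_reset_of_matched {k : ℕ} (h : n - st b 0 ε n ≤ k) (hk : k < n) :
    ¬ ε k < b (st b 0 ε k) := by
  intro hlt
  have h1 := st_matched (b := b) (ε := ε) (n := n) (k := k + 1) (by omega) hk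
  rw [st_succ, if_pos hlt] at h1
  omega

theorem matched_eq {k : ℕ} (hε : ε ∈ Adm b 0) (h : n - st b 0 ε n ≤ k) (hk : k < n) :
    ε k = b (k - (n - st b 0 ε n)) := by
  have h1 := not_reset_of_matched h hk
  have h2 := hε k
  rw [st_matched h hk.le] at h1 h2
  omega

/-- Every position before a reset belongs to the matched part of a reset. -/
theorem exists_matched {k : ℕ} (hkn : k ≤ n) (P : ℕ → Prop) (hP : P n)
    (hR : ∀ m, ε m < b (st b 0 ε m) → m < n → P m) :
    ∃ m, k ≤ m ∧ m ≤ n ∧ P m ∧ m - st b 0 ε m ≤ k := by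
  classical
  have hex : ∃ m, k ≤ m ∧ P m := ⟨n, hkn, hP⟩
  obtain ⟨hm1, hm2⟩ := Nat.find_spec hex
  have hmn : Nat.find hex ≤ n := Nat.find_min' hex ⟨hkn, hP⟩
  refine ⟨Nat.find hex, hm1, hmn, hm2, ?_⟩
  have h1 : ∀ j, j < Nat.find hex - k → ¬ tl k ε j < b (st b (st b 0 ε k) (tl k ε) j) := by
    intro j hj hlt
    rw [st_tl] at hlt
    exact Nat.find_min hex (m := k + j) (by omega) ⟨by omega, hR _ hlt (by omega)⟩
  have h2 := st_eq_of_forall_not_lt h1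
  rw [st_tl, Nat.add_sub_cancel' hm1] at h2
  omega

/-- The matched parts of different resets are disjoint. -/
theorem matched_disjoint {m m' : ℕ} (hm : ε m < b (st b 0 ε m)) (h : m < m') :
    m < m' - st b 0 ε m' := by
  by_contra hcon
  exact not_reset_of_matched (by omega) h hm

end GenZeck

namespace GenZeck
variable {b : Coeff} {i n : ℕ} {ε ζ ξ : Coeff} {w : ℝ} {L : List ℕ}

/-! ### Star blocks as the matched parts of resets. -/

open Classical in
/-- The restriction of `ε` to the part matched when the digit at position `m` is read. -/
noncomputable def blockAt (b ε : Coeff) (m : ℕ) : Coeff :=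
  fun k => if m - st b 0 ε m ≤ k ∧ k ≤ m then ε k else 0

theorem blockAt_of_mem {m k : ℕ} (h : m - st b 0 ε m ≤ k) (hk : k ≤ m) :
    blockAt b ε m k = ε k := if_pos ⟨h, hk⟩

theorem blockAt_of_not_mem {m k : ℕ} (h : ¬ (m - st b 0 ε m ≤ k ∧ k ≤ m)) :
    blockAt b ε m k = 0 := if_neg h

theorem maxStar_of_le {L : List ℕ} {n k : ℕ} (h : n ≤ k) : maxStar L n k = periodic L (k - n) :=
  if_pos h

theorem maxStar_of_lt {L : List ℕ} {n k : ℕ} (h : k < n) : maxStar L n k = 0 :=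
  if_neg (not_le.2 h)

theorem rev_of_lt {k : ℕ} (h : k < n) : rev n ε k = ε (n - 1 - k) := if_pos h

theorem rev_of_ge {k : ℕ} (h : n ≤ k) : rev n ε k = 0 := if_neg (not_lt.2 h)

theorem isProperStarBlock_blockAt (hε : ε ∈ Adm (periodic L) 0) {m : ℕ}
    (hm : ε m < periodic L (st (periodic L) 0 ε m)) :
    IsProperStarBlock L (m - st (periodic L) 0 ε m) m (blockAt (periodic L) ε m) := by
  have hle := st_le (periodic L) ε m
  refine ⟨by omega, fun j hj => ?_, ?_, fun j hj => blockAt_of_not_mem (by omega)⟩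
  · by_cases h : m - st (periodic L) 0 ε m ≤ j
    · rw [blockAt_of_mem h hj.le, maxStar_of_le h, matched_eq hε h hj]
    · rw [blockAt_of_not_mem (by omega), maxStar_of_lt (by omega)]
  · rw [blockAt_of_mem (by omega) le_rfl, maxStar_of_le (by omega)]
    rwa [Nat.sub_sub_self hle]

theorem IsProperStarBlock.eq_zero {k c : ℕ} (h : IsProperStarBlock L k c ζ) {p : ℕ}
    (hp : p ∉ Icc k c) : ζ p = 0 := by
  obtain ⟨h1, h2, h3, h4⟩ := h
  by_cases hc : c < p
  · exact h4 p hc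
  · have : p < k := by
      by_contra hk
      exact hp ⟨by omega, by omega⟩
    rw [h2 p (by omega), maxStar_of_lt this]

theorem IsProperStarBlock.eq_periodic {k c : ℕ} (h : IsProperStarBlock L k c ζ) {p : ℕ}
    (hp : k ≤ p) (hc : p < c) : ζ p = periodic L (p - k) := by
  rw [h.2.1 p hc, maxStar_of_le hp]

theorem IsProperStarBlock.lt_periodic {k c : ℕ} (h : IsProperStarBlock L k c ζ) :
    ζ c < periodic L (c - k) := by
  have := h.2.2.1
  rwa [maxStar_of_le h.1] at this

theorem IsProperStarBlock.le_periodic {k c : ℕ} (h : IsProperStarBlock L k c ζ) {p : ℕ}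
    (hp : p ∈ Icc k c) : ζ p ≤ periodic L (p - k) := by
  rcases hp.2.eq_or_lt with rfl | hlt
  · exact h.lt_periodic.le
  · exact (h.eq_periodic hp.1 hlt).le

/-- Blocks end at resets, and a position outside all blocks is itself a reset, having digit zero and
state zero. Conversely, the matched parts of the resets are disjoint proper blocks, and they cover
everything once the resets never stop. -/
theorem mem_starCollection_iff (hb : 0 < periodic L 0) :
    ε ∈ starCollection L ↔ ε ∈ Adm (periodic L) 0 ∧ ε ≠ 0 ∧
      ∀ m, ∃ n ≥ m, ε n < periodic L (st (periodic L) 0 ε n) := by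
  constructor
  · rintro ⟨h0, I, ζ, a, c, hblk, hdis, hsum⟩
    let S : I → Set ℕ := fun j => Icc (a j) (c j)
    have huniq : ∀ j j' : I, ∀ p, p ∈ S j → p ∈ S j' → j = j' := by
      intro j j' p hp hp'
      by_contra hne
      exact Set.disjoint_left.1 (hdis j.2 j'.2 fun h => hne (Subtype.ext h)) hp hp'
    have hval : ∀ j : I, ∀ p ∈ S j, ε p = ζ j p := by
      classical
      intro j p hp
      rw [hsum, finsum_eq_single _ (j : ℕ), finsum_eq_if, if_pos j.2]
      intro x hx
      rw [finsum_eq_if]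
      split_ifs with hxI
      · exact (hblk x hxI).eq_zero fun h =>
          hx (congrArg Subtype.val (huniq ⟨x, hxI⟩ j p h hp))
      · rfl
    have hzero : ∀ p, (∀ j, p ∉ S j) → ε p = 0 := by
      intro p hp
      rw [hsum]
      exact finsum_mem_eq_zero_of_forall_eq_zero fun x hx => (hblk x hx).eq_zero (hp ⟨x, hx⟩)
    have h1 : ∀ j, ∀ p ∈ S j, a j ≤ p := fun j p hp => hp.1
    have h1' : ∀ n, ∀ j, ∀ p ∈ S j, p < n → ε p ≤ periodic L (p - a j) := by
      intro n j p hp _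
      rw [hval j p hp]
      exact (hblk j j.2).le_periodic hp
    have h2 : ∀ n, ∀ j, ∀ p ∈ S j, p + 1 < n → p + 1 ∈ S j → ε p = periodic L (p - a j) := by
      intro n j p hp _ hp'
      rw [hval j p hp]
      exact (hblk j j.2).eq_periodic hp.1 hp'.2
    have h2' : ∀ n, ∀ j, ∀ p ∈ S j, p + 1 < n → p + 1 ∉ S j → ε p < periodic L (p - a j) := by
      intro n j p hp _ hp'
      rw [hval j p hp]
      obtain rfl : p = c j := by
        refine le_antisymm hp.2 ?_
        by_contra hlt
        exact hp' ⟨by have := hp.1; omega, by omega⟩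
      exact (hblk j j.2).lt_periodic
    have h3 : ∀ j p, p + 1 ∈ S j → p ∉ S j → a j = p + 1 := by
      intro j p hp hp'
      refine le_antisymm hp.1 ?_
      by_contra hlt
      exact hp' ⟨by omega, by have := hp.2; omega⟩
    refine ⟨fun n => le_of_blocks hb (n + 1) S (fun j => a j) h1 (h1' _) (h2 _) (h2' _) h3 huniq
      (fun p _ => hzero p) n (by omega), h0, fun m => ?_⟩
    have hst := fun p => st_of_blocks hb (p + 1) S (fun j => a j) h1 (h2 _) (h2' _) h3 huniq
      (fun p _ => hzero p) p (by omega)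
    by_cases hc : ∃ j, m ∈ S j
    · obtain ⟨j, hj⟩ := hc
      have hcj : c j ∈ S j := ⟨(hblk j j.2).1, le_rfl⟩
      refine ⟨c j, hj.2, ?_⟩
      rw [(hst (c j)).1 j hcj, hval j _ hcj]
      exact (hblk j j.2).lt_periodic
    · push Not at hc
      exact ⟨m, le_rfl, by rw [(hst m).2 hc, hzero m hc]; exact hb⟩
  · rintro ⟨hε, h0, hinf⟩
    refine ⟨h0, {m | ε m < periodic L (st (periodic L) 0 ε m)}, blockAt (periodic L) ε,
      fun m => m - st (periodic L) 0 ε m, id, fun m hm => isProperStarBlock_blockAt hε hm, ?_,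
      fun k => ?_⟩
    · intro m hm m' hm' hne
      refine Set.disjoint_left.2 fun p hp hp' => ?_
      rcases lt_or_gt_of_ne hne with hlt | hlt
      · have := matched_disjoint hm hlt
        have := hp.2
        have := hp'.1
        simp only [id] at *
        omega
      · have := matched_disjoint hm' hlt
        have := hp'.2
        have := hp.1
        simp only [id] at *
        omega
    · obtain ⟨n, hn, hlt⟩ := hinf k
      obtain ⟨m, hm1, -, hm2, hm3⟩ := exists_matched hn _ hlt fun m hm _ => hm
      rw [finsum_eq_single _ m, finsum_eq_if, if_pos (by exact hm2), blockAt_of_mem hm3 hm1]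
      intro x hx
      rw [finsum_eq_if]
      split_ifs with hxI
      · refine blockAt_of_not_mem fun h => ?_
        rcases lt_or_gt_of_ne hx with hlt | hlt
        · have := matched_disjoint hxI hlt
          omega
        · have := matched_disjoint hm2 hlt
          omega
      · rfl

/-- The positions below `n` at which a reset occurs, and the last position. -/
noncomputable def ends (b ε : Coeff) (n : ℕ) : Finset ℕ := by
  classical
  exact (Finset.range n).filter fun m => ε m < b (st b 0 ε m) ∨ m + 1 = n

theorem mem_ends {m : ℕ} :
    m ∈ ends b ε n ↔ m < n ∧ (ε m < b (st b 0 ε m) ∨ m + 1 = n) := by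
  simp [ends]

theorem ends_disjoint {m m' : ℕ} (hm : m ∈ ends b ε n) (hm' : m' ∈ ends b ε n) (h : m < m') :
    m < m' - st b 0 ε m' := by
  rw [mem_ends] at hm hm'
  exact matched_disjoint (hm.2.resolve_right (by omega)) h

theorem sum_blockAt_ends (b ε : Coeff) (n k : ℕ) :
    ∑ m ∈ ends b ε n, blockAt b ε m k = if k < n then ε k else 0 := by
  split_ifs with hk
  · obtain ⟨m, hm1, hm2, hm3, hm4⟩ := exists_matched (n := n - 1) (b := b) (ε := ε)
      (show k ≤ n - 1 by omega) (fun m => m ∈ ends b ε n)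
      (mem_ends.2 ⟨by omega, Or.inr (by omega)⟩)
      (fun m hm hmn => mem_ends.2 ⟨by omega, Or.inl hm⟩)
    rw [Finset.sum_eq_single_of_mem m hm3, blockAt_of_mem hm4 hm1]
    intro x hx hne
    refine blockAt_of_not_mem fun h => ?_
    rcases lt_or_gt_of_ne hne with hlt | hlt
    · have := ends_disjoint hx hm3 hlt
      omega
    · have := ends_disjoint hm3 hx hlt
      omega
  · refine Finset.sum_eq_zero fun m hm => blockAt_of_not_mem ?_
    have := (mem_ends.1 hm).1
    omega

/-- Dropping the demand for infinitely many resets adds exactly the sequences that copy the bound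
after their last reset; this copy is the maximal star block. -/
theorem mem_starClosure_iff (hb : 0 < periodic L 0) :
    ε ∈ starClosure L ↔ ε ∈ Adm (periodic L) 0 ∧ ε ≠ 0 := by
  constructor
  · rintro (h | ⟨s, ζ, a, c, d, hblk, hdis, -, rfl⟩)
    · obtain ⟨h1, h2, -⟩ := (mem_starCollection_iff hb).1 h
      exact ⟨h1, h2⟩
    set ε : Coeff := (∑ i, ζ i) + maxStar L d with hεdef
    have hε : ∀ p, ε p = (∑ i, ζ i p) + maxStar L d p := fun p => by
      rw [hεdef, Pi.add_apply, Finset.sum_apply]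
    let S : Option (Fin s) → Set ℕ := fun j => j.elim (Ici d) fun j => Icc (a j) (c j)
    let a' : Option (Fin s) → ℕ := fun j => j.elim d a
    have huniq : ∀ j j', ∀ p, p ∈ S j → p ∈ S j' → j = j' := by
      rintro (_ | j) (_ | j') p hp hp'
      · rfl
      · have h1 : d ≤ p := hp
        have h2 : p ≤ c j' := hp'.2
        have := (hblk j').2
        omega
      · have h1 : d ≤ p := hp'
        have h2 : p ≤ c j := hp.2
        have := (hblk j).2
        omega
      · by_contra hne
        exact Set.disjoint_left.1 (hdis fun h => hne (congrArg some h)) hp hp'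
    have hval : ∀ j, ∀ p ∈ Icc (a j) (c j), ε p = ζ j p := by
      intro j p hp
      have h1 : p < d := hp.2.trans_lt (hblk j).2
      rw [hε, maxStar_of_lt h1, add_zero, Finset.sum_eq_single_of_mem j (Finset.mem_univ _)]
      intro x _ hx
      exact (hblk x).1.eq_zero fun h => hx (Option.some_injective _ (huniq (some x) (some j) p h hp))
    have hval' : ∀ p, d ≤ p → ε p = periodic L (p - d) := by
      intro p hp
      rw [hε, maxStar_of_le hp, Finset.sum_eq_zero, zero_add]
      intro x _
      refine (hblk x).1.eq_zero fun h => ?_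
      have := (hblk x).2
      have := h.2
      omega
    have hadm : ε ∈ Adm (periodic L) 0 := by
      intro n
      refine le_of_blocks hb (n + 1) S a' ?_ ?_ ?_ ?_ ?_ huniq ?_ n (by omega)
      · rintro (_ | j) p hp
        · exact hp
        · exact hp.1
      · rintro (_ | j) p hp -
        · exact (hval' p hp).le
        · rw [hval j p hp]
          exact (hblk j).1.le_periodic hp
      · rintro (_ | j) p hp - hp'
        · exact hval' p hp
        · rw [hval j p hp]
          exact (hblk j).1.eq_periodic hp.1 hp'.2
      · rintro (_ | j) p hp - hp'
        · exact absurd (le_trans hp (Nat.le_succ p) : d ≤ p + 1) hp'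
        · obtain rfl : p = c j := by
            refine le_antisymm hp.2 ?_
            by_contra hlt
            exact hp' ⟨by have := hp.1; omega, by omega⟩
          rw [hval j _ hp]
          exact (hblk j).1.lt_periodic
      · rintro (_ | j) p hp hp'
        · have h1 : d ≤ p + 1 := hp
          have h2 : ¬ d ≤ p := hp'
          change d = p + 1
          omega
        · refine le_antisymm (show a j ≤ p + 1 from hp.1) (not_lt.1 fun hlt => ?_)
          have hlt' : a j < p + 1 := hlt
          exact hp' ⟨by omega, by have := hp.2; omega⟩
      · intro p _ hp
        rw [hε, maxStar_of_lt (not_le.1 (hp none)), add_zero]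
        exact Finset.sum_eq_zero fun x _ => (hblk x).1.eq_zero (hp (some x))
    refine ⟨hadm, fun h => ?_⟩
    have h1 := hval' d le_rfl
    rw [h, Nat.sub_self] at h1
    exact hb.ne h1
  · rintro ⟨hε, h0⟩
    by_cases hinf : ∀ m, ∃ n ≥ m, ε n < periodic L (st (periodic L) 0 ε n)
    · exact Or.inl ((mem_starCollection_iff hb).2 ⟨hε, h0, hinf⟩)
    right
    classical
    push Not at hinf
    -- `d` is the first position from which no reset occurs. By minimality either `d = 0` or
    -- position `d - 1` is a reset, so the maximal block starts right after the last proper one.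
    set d := Nat.find hinf with hd
    have hd1 : ∀ n ≥ d, ¬ ε n < periodic L (st (periodic L) 0 ε n) :=
      fun n hn => not_lt.2 (Nat.find_spec hinf n hn)
    have hd2 : ∀ m, m + 1 = d → ε m < periodic L (st (periodic L) 0 ε m) := by
      intro m hm
      by_contra hcon
      refine Nat.find_min hinf (m := m) (by omega) fun n hn => ?_
      rcases (show m ≤ n from hn).eq_or_lt with rfl | hlt
      · exact not_lt.1 hcon
      · exact not_lt.1 (hd1 n (by omega))
    have hreset : ∀ m ∈ ends (periodic L) ε d, ε m < periodic L (st (periodic L) 0 ε m) := by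
      intro m hm
      rcases (mem_ends.1 hm).2 with h | h
      · exact h
      · exact hd2 m h
    have hstd : st (periodic L) 0 ε d = 0 := by
      rcases Nat.eq_zero_or_pos d with h | h
      · rw [h]; rfl
      · obtain ⟨m, hm⟩ := Nat.exists_eq_add_of_le' h
        rw [hm, st_succ, if_pos (hd2 m hm.symm)]
    let e := (ends (periodic L) ε d).equivFin
    refine ⟨_, fun j => blockAt (periodic L) ε (e.symm j),
      fun j => (e.symm j : ℕ) - st (periodic L) 0 ε (e.symm j), fun j => e.symm j, d,
      fun j => ⟨isProperStarBlock_blockAt hε (hreset _ (e.symm j).2),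
        (mem_ends.1 (e.symm j).2).1⟩, ?_, ?_, ?_⟩
    · intro j j' hne
      have hne' : (e.symm j : ℕ) ≠ e.symm j' := fun h => hne (e.symm.injective (Subtype.ext h))
      refine Set.disjoint_left.2 fun p hp hp' => ?_
      rcases lt_or_gt_of_ne hne' with hlt | hlt
      · have := ends_disjoint (e.symm j).2 (e.symm j').2 hlt
        have : p ≤ e.symm j := hp.2
        have : (e.symm j' : ℕ) - st (periodic L) 0 ε (e.symm j') ≤ p := hp'.1
        omega
      · have := ends_disjoint (e.symm j').2 (e.symm j).2 hlt
        have : p ≤ e.symm j' := hp'.2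
        have : (e.symm j : ℕ) - st (periodic L) 0 ε (e.symm j) ≤ p := hp.1
        omega
    · rcases Nat.eq_zero_or_pos d with h | h
      · refine Or.inl ⟨?_, h⟩
        rw [h]
        simp [ends]
      · right
        have hmem : d - 1 ∈ ends (periodic L) ε d := mem_ends.2 ⟨by omega, Or.inr (by omega)⟩
        refine ⟨e ⟨d - 1, hmem⟩, ?_⟩
        simp only [Equiv.symm_apply_apply]
        exact Nat.sub_add_cancel h
    · funext k
      rw [Pi.add_apply, Finset.sum_apply,
        Equiv.sum_comp e.symm (fun m => blockAt (periodic L) ε (m : ℕ) k),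
        Finset.sum_coe_sort (ends (periodic L) ε d) (fun m => blockAt (periodic L) ε m k),
        sum_blockAt_ends]
      split_ifs with hk
      · rw [maxStar_of_lt hk, add_zero]
      · have h1 : tl d ε = tl 0 (periodic L) := by
          have := adm_tl hε d
          rw [hstd] at this
          refine adm_eq_tl this fun j => ?_
          have h2 := hd1 (d + j) (by omega)
          rwa [← st_tl, hstd] at h2
        have h2 := congrFun h1 (k - d)
        rw [maxStar_of_le (not_lt.1 hk), zero_add]
        simpa [tl, Nat.add_sub_cancel' (not_lt.1 hk)] using h2

/-! ### Collections for integers -/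

/-- A matched part ended by a reset reverses to a proper block. Truncation at `n` may leave an
unfinished match; it reverses to a block reaching index `0`, which is the maximal one. -/
theorem isBlock_rev_blockAt (hε : ε ∈ Adm (periodic L) 0) {m : ℕ}
    (hm : m ∈ ends (periodic L) ε n) :
    IsBlock L (n - 1 - m) (n - (m - st (periodic L) 0 ε m)) (rev n (blockAt (periodic L) ε m)) := by
  obtain ⟨hmn, hm'⟩ := mem_ends.1 hm
  have hle := st_le (periodic L) ε m
  have heq : ∀ j, n - 1 - m < j → rev n (blockAt (periodic L) ε m) j =
      rev (n - (m - st (periodic L) 0 ε m)) (periodic L) j := by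
    intro j hj
    by_cases hjn : j < n - (m - st (periodic L) 0 ε m)
    · rw [rev_of_lt (by omega), rev_of_lt hjn, blockAt_of_mem (by omega) (by omega),
        matched_eq (n := m) hε (by omega) (by omega)]
      exact congrArg _ (by omega)
    · rw [rev_of_ge (not_lt.1 hjn)]
      by_cases hjn' : j < n
      · rw [rev_of_lt hjn', blockAt_of_not_mem (by omega)]
      · rw [rev_of_ge (not_lt.1 hjn')]
  have hend : rev n (blockAt (periodic L) ε m) (n - 1 - m) = ε m := by
    rw [rev_of_lt (by omega), show n - 1 - (n - 1 - m) = m by omega,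
      blockAt_of_mem (by omega) le_rfl]
  have hend' : rev (n - (m - st (periodic L) 0 ε m)) (periodic L) (n - 1 - m) =
      periodic L (st (periodic L) 0 ε m) := by
    rw [rev_of_lt (by omega)]
    exact congrArg _ (by omega)
  by_cases hlt : ε m < periodic L (st (periodic L) 0 ε m)
  · refine Or.inl ⟨by omega, heq, by rwa [hend, hend'], fun j hj => ?_⟩
    rw [rev_of_lt (by omega), blockAt_of_not_mem (by omega)]
  · have hmn' := hm'.resolve_left hlt
    refine Or.inr ⟨by omega, by omega, ?_⟩
    funext j
    rcases Nat.eq_zero_or_pos j with rfl | hj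
    · rw [show n - 1 - m = 0 by omega] at hend hend'
      rw [hend, hend']
      exact le_antisymm (hε m) (not_lt.1 hlt)
    · exact heq j (by omega)

theorem rev_mem_collection (hε : ε ∈ Adm (periodic L) 0) (n : ℕ) : rev n ε ∈ collection L := by
  let e := (ends (periodic L) ε n).equivFin
  refine ⟨_, fun j => rev n (blockAt (periodic L) ε (e.symm j)), fun j => n - 1 - e.symm j,
    fun j => n - ((e.symm j : ℕ) - st (periodic L) 0 ε (e.symm j)),
    fun j => isBlock_rev_blockAt hε (e.symm j).2, ?_, ?_⟩
  · intro j j' hne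
    have hne' : (e.symm j : ℕ) ≠ e.symm j' := fun h => hne (e.symm.injective (Subtype.ext h))
    have h1 := (mem_ends.1 (e.symm j).2).1
    have h2 := (mem_ends.1 (e.symm j').2).1
    refine Set.disjoint_left.2 fun p hp hp' => ?_
    simp only [mem_Ico] at hp hp'
    rcases lt_or_gt_of_ne hne' with hlt | hlt
    · have := ends_disjoint (e.symm j).2 (e.symm j').2 hlt
      omega
    · have := ends_disjoint (e.symm j').2 (e.symm j).2 hlt
      omega
  · funext k
    rw [Finset.sum_apply]
    by_cases hk : k < n
    · have h1 : ∀ j, rev n (blockAt (periodic L) ε (e.symm j)) k =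
          blockAt (periodic L) ε (e.symm j) (n - 1 - k) := fun j => rev_of_lt hk
      simp only [h1]
      rw [Equiv.sum_comp e.symm (fun m => blockAt (periodic L) ε (m : ℕ) (n - 1 - k)),
        Finset.sum_coe_sort (ends (periodic L) ε n)
          (fun m => blockAt (periodic L) ε m (n - 1 - k)),
        sum_blockAt_ends, rev_of_lt hk, if_pos (by omega)]
    · rw [rev_of_ge (not_lt.1 hk)]
      exact (Finset.sum_eq_zero fun j _ => rev_of_ge (not_lt.1 hk)).symm

theorem IsBlock.lt {k : ℕ} (h : IsBlock L k n ζ) : k < n := by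
  rcases h with h | ⟨rfl, h, -⟩
  · exact h.1
  · exact h

theorem IsBlock.eq_zero {k p : ℕ} (h : IsBlock L k n ζ) (hp : p ∉ Ico k n) : ζ p = 0 := by
  have hkn := h.lt
  rcases h with ⟨h1, h2, -, h4⟩ | ⟨rfl, h, rfl⟩
  · by_cases hc : p < k
    · exact h4 p hc
    · have : n ≤ p := by
        by_contra hk
        exact hp ⟨by omega, by omega⟩
      rw [h2 p (by omega), rev_of_ge this]
  · refine rev_of_ge ?_
    by_contra hk
    exact hp ⟨by omega, by omega⟩

theorem IsBlock.eq_rev {k p : ℕ} (h : IsBlock L k n ζ) (hp : k < p) :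
    ζ p = rev n (periodic L) p := by
  rcases h with h | ⟨-, -, rfl⟩
  · exact h.2.1 p hp
  · rfl

theorem IsBlock.le_rev {k p : ℕ} (h : IsBlock L k n ζ) (hp : k ≤ p) :
    ζ p ≤ rev n (periodic L) p := by
  rcases hp.eq_or_lt with rfl | hlt
  · rcases h with h | ⟨-, -, rfl⟩
    · exact h.2.2.1.le
    · exact le_rfl
  · exact (h.eq_rev hlt).le

/-- After reversal a block with upper end `c j` starts at `n - c j`, and the strict drop at its
lower end becomes a reset. -/
theorem rev_sum_mem_Adm (hb : 0 < periodic L 0) {s : ℕ} {ζ : Fin s → Coeff} {a c : Fin s → ℕ}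
    (hblk : ∀ i, IsBlock L (a i) (c i) (ζ i))
    (hdis : Pairwise fun i j => Disjoint (Ico (a i) (c i)) (Ico (a j) (c j)))
    (hn : ∀ i, c i ≤ n) : rev n (∑ i, ζ i) ∈ Adm (periodic L) 0 := by
  intro k
  rcases le_or_gt n k with hk | hk
  · rw [rev_of_ge hk]
    exact Nat.zero_le _
  let S : Fin s → Set ℕ := fun j => {p | p < n ∧ n - 1 - p ∈ Ico (a j) (c j)}
  have huniq : ∀ j j', ∀ p, p ∈ S j → p ∈ S j' → j = j' := by
    intro j j' p hp hp'
    by_contra hne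
    exact Set.disjoint_left.1 (hdis hne) hp.2 hp'.2
  have hε : ∀ p < n, rev n (∑ i, ζ i) p = ∑ i, ζ i (n - 1 - p) := fun p hp => by
    rw [rev_of_lt hp, Finset.sum_apply]
  have hval : ∀ j, ∀ p ∈ S j, rev n (∑ i, ζ i) p = ζ j (n - 1 - p) := by
    intro j p hp
    rw [hε p hp.1, Finset.sum_eq_single_of_mem j (Finset.mem_univ _)]
    intro x _ hx
    exact (hblk x).eq_zero fun h => hx (huniq x j p ⟨hp.1, h⟩ hp)
  have hrev : ∀ j, ∀ p ∈ S j,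
      rev (c j) (periodic L) (n - 1 - p) = periodic L (p - (n - c j)) := by
    intro j p hp
    have h1 := hp.1
    have h2 := hp.2.2
    have := hn j
    rw [rev_of_lt h2]
    congr 1
    omega
  refine le_of_blocks hb n S (fun j => n - c j) ?_ ?_ ?_ ?_ ?_ huniq ?_ k hk
  · intro j p hp
    have h1 := hp.1
    have h2 := hp.2.2
    have := hn j
    change n - c j ≤ p
    omega
  · intro j p hp _
    rw [hval j p hp, ← hrev j p hp]
    exact (hblk j).le_rev hp.2.1
  · intro j p hp _ hp'
    have h1 := hp.1
    have h2 := hp'.2.1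
    rw [hval j p hp, ← hrev j p hp]
    exact (hblk j).eq_rev (by omega)
  · intro j p hp hpn hp'
    have h1 := hp.2.1
    have h2 := hp.2.2
    have h3 : n - 1 - p = a j := by
      by_contra hne
      exact hp' ⟨hpn, by omega, by omega⟩
    rw [hval j p hp, ← hrev j p hp, h3]
    rcases hblk j with h | ⟨h, -⟩
    · exact h.2.2.1
    · omega
  · intro j p hp hp'
    have h0 := hp.1
    have h1 := hp.2.1
    have h2 := hp.2.2
    have h3 := hn j
    change n - c j = p + 1
    by_contra hne
    exact hp' ⟨by omega, by omega, by omega⟩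
  · intro p hp h
    rw [hε p hp]
    exact Finset.sum_eq_zero fun j _ => (hblk j).eq_zero fun h' => h j ⟨hp, h'⟩

theorem st_eq_zero_of_zeros (hb : 0 < b 0) (h : ∀ k < n, ε k = 0) : st b 0 ε n = 0 := by
  induction n with
  | zero => rfl
  | succ n ih =>
    rw [st_succ, ih fun k hk => h k (by omega), h n (by omega), if_pos hb]

theorem rev_mem_Adm (hb : 0 < periodic L 0) {μ : Coeff} (hμ : μ ∈ collection L)
    (hn : ∀ k, n ≤ k → μ k = 0) : rev n μ ∈ Adm (periodic L) 0 := by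
  obtain ⟨s, ζ, a, c, hblk, hdis, rfl⟩ := hμ
  -- Blocks may have zero digits at the top, so their support intervals can exceed `n`. Reversing at
  -- `n + m` leaves room for all of them; the `m` leading zeros are then removed without changing
  -- the state.
  set m := ∑ i, c i with hm
  have h1 : rev (n + m) (∑ i, ζ i) ∈ Adm (periodic L) 0 := by
    refine rev_sum_mem_Adm hb hblk hdis fun i => ?_
    have := Finset.single_le_sum (f := c) (fun _ _ => Nat.zero_le _) (Finset.mem_univ i)
    omega
  have h2 : ∀ k < m, rev (n + m) (∑ i, ζ i) k = 0 := by
    intro k hk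
    rw [rev_of_lt (by omega)]
    exact hn _ (by omega)
  have h3 := adm_tl h1 m
  rw [st_eq_zero_of_zeros hb h2] at h3
  convert h3 using 1
  funext k
  rw [tl]
  by_cases hk : k < n
  · rw [rev_of_lt hk, rev_of_lt (by omega)]
    exact congrArg _ (by omega)
  · rw [rev_of_ge (by omega), rev_of_ge (by omega)]

end GenZeck

namespace GenZeck
variable {b : Coeff} {i n : ℕ} {ε ζ ξ μ ν ρ : Coeff} {w : ℝ} {L : List ℕ}

/-! ### The ascending lexicographical order -/

theorem AscLt.irrefl (ε : Coeff) : ¬ AscLt ε ε := fun ⟨_, _, h⟩ => lt_irrefl _ h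

theorem AscLt.trans (h : AscLt ε ζ) (h' : AscLt ζ ξ) : AscLt ε ξ := by
  obtain ⟨k, hk, hlt⟩ := h
  obtain ⟨m, hm, hlt'⟩ := h'
  rcases lt_trichotomy k m with hkm | rfl | hkm
  · exact ⟨m, fun j hj => (hk j (hkm.trans hj)).trans (hm j hj), (hk m hkm).symm ▸ hlt'⟩
  · exact ⟨k, fun j hj => (hk j hj).trans (hm j hj), hlt.trans hlt'⟩
  · exact ⟨k, fun j hj => (hk j hj).trans (hm j (hkm.trans hj)), hm k hkm ▸ hlt⟩

theorem rev_rev (n : ℕ) (ε : Coeff) : rev n (rev n ε) = app n ε 0 := by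
  funext k
  by_cases hk : k < n
  · rw [rev_of_lt hk, rev_of_lt (by omega), app_of_lt hk]
    exact congrArg _ (by omega)
  · rw [rev_of_ge (not_lt.1 hk), app, if_neg hk]
    rfl

theorem app_zero_of_zero (h : ∀ k, n ≤ k → ε k = 0) : app n ε 0 = ε := by
  funext k
  by_cases hk : k < n
  · rw [app_of_lt hk]
  · rw [app, if_neg hk, h k (not_lt.1 hk)]
    rfl

theorem rev_rev_of_zero (h : ∀ k, n ≤ k → ε k = 0) : rev n (rev n ε) = ε := by
  rw [rev_rev, app_zero_of_zero h]

theorem descLt_rev (hν : ∀ k, n ≤ k → ν k = 0) (h : AscLt μ ν) :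
    DescLt (rev n μ) (rev n ν) := by
  obtain ⟨k, hk, hlt⟩ := h
  have hkn : k < n := by
    by_contra hcon
    rw [hν k (not_lt.1 hcon)] at hlt
    omega
  refine ⟨n - 1 - k, fun j hj => ?_, ?_⟩
  · rw [rev_of_lt (by omega), rev_of_lt (by omega), hk _ (by omega)]
  · rw [rev_of_lt (by omega), rev_of_lt (by omega), show n - 1 - (n - 1 - k) = k by omega]
    exact hlt

theorem ascLt_rev (hζ : ∀ k, n ≤ k → ζ k = 0) (h : DescLt ε ζ) :
    AscLt (rev n ε) (rev n ζ) := by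
  obtain ⟨k, hk, hlt⟩ := h
  have hkn : k < n := by
    by_contra hcon
    rw [hζ k (not_lt.1 hcon)] at hlt
    omega
  refine ⟨n - 1 - k, fun j hj => ?_, ?_⟩
  · by_cases hj' : j < n
    · rw [rev_of_lt hj', rev_of_lt hj', hk _ (by omega)]
    · rw [rev_of_ge (not_lt.1 hj'), rev_of_ge (not_lt.1 hj')]
  · rw [rev_of_lt (by omega), rev_of_lt (by omega), show n - 1 - (n - 1 - k) = k by omega]
    exact hlt

theorem ascLt_trichotomy (hμ : ∀ k, n ≤ k → μ k = 0) (hν : ∀ k, n ≤ k → ν k = 0) :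
    AscLt μ ν ∨ μ = ν ∨ AscLt ν μ := by
  have hz : ∀ ε : Coeff, ∀ k, n ≤ k → rev n ε k = 0 := fun ε k hk => rev_of_ge hk
  rcases descLt_trichotomy (rev n μ) (rev n ν) with h | h | h
  · have := ascLt_rev (hz ν) h
    rw [rev_rev_of_zero hμ, rev_rev_of_zero hν] at this
    exact Or.inl this
  · have := congrArg (rev n) h
    rw [rev_rev_of_zero hμ, rev_rev_of_zero hν] at this
    exact Or.inr (Or.inl this)
  · have := ascLt_rev (hz μ) h
    rw [rev_rev_of_zero hμ, rev_rev_of_zero hν] at this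
    exact Or.inr (Or.inr this)

theorem AscLt.zero_of_ge (h : AscLt ν μ) (hμ : ∀ k, n ≤ k → μ k = 0) (k : ℕ) (hk : n ≤ k) :
    ν k = 0 := by
  obtain ⟨m, hm, hlt⟩ := h
  have : m < n := by
    by_contra hcon
    rw [hμ m (not_lt.1 hcon)] at hlt
    omega
  rw [hm k (by omega), hμ k hk]

/-! ### The immediate successor of the predecessor -/

instance : IsStrictOrder Coeff fun μ ν => AscLt ν μ where
  irrefl := AscLt.irrefl
  trans _ _ _ h h' := h'.trans h

/-- No member of `E` lies in the interval from `μ` up to but excluding `ρ`, so the successor of the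
largest member below `μ` is `ρ`. -/
theorem bar_eq {E : Set Coeff} (hfin : {ν | ν ∈ E ∧ AscLt ν μ}.Finite)
    (hne : {ν | ν ∈ E ∧ AscLt ν μ}.Nonempty)
    (htri : ∀ ξ ∈ E, ∀ ξ' ∈ E, AscLt ξ ξ' ∨ ξ = ξ' ∨ AscLt ξ' ξ)
    (hρ : ρ ∈ E) (hμρ : μ = ρ ∨ AscLt μ ρ) (hmin : ∀ ξ ∈ E, AscLt ξ ρ → AscLt ξ μ) :
    bar E μ = ρ := by
  have hpred : ∃ ν, ν ∈ E ∧ AscLt ν μ ∧ ∀ ξ ∈ E, AscLt ξ μ → ξ = ν ∨ AscLt ξ ν := by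
    -- For the reversed order, a minimal element of the finite set is its largest member.
    have hwf := hfin.wellFoundedOn (r := fun μ ν => AscLt ν μ)
    obtain ⟨x, hx⟩ := hne
    obtain ⟨m, -, hm⟩ := WellFounded.has_min hwf univ ⟨⟨x, hx⟩, mem_univ _⟩
    refine ⟨m, m.2.1, m.2.2, fun ξ hξ hξμ => ?_⟩
    rcases htri ξ hξ m m.2.1 with h | h | h
    · exact Or.inr h
    · exact Or.inl h
    · exact absurd h (hm ⟨ξ, hξ, hξμ⟩ (mem_univ _))
  obtain ⟨hp1, hp2, hp3⟩ := Classical.epsilon_spec hpred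
  change pred E μ ∈ E at hp1
  change AscLt (pred E μ) μ at hp2
  change ∀ ξ ∈ E, AscLt ξ μ → ξ = pred E μ ∨ AscLt ξ (pred E μ) at hp3
  have hρ2 : AscLt (pred E μ) ρ := by
    rcases hμρ with rfl | h
    · exact hp2
    · exact hp2.trans h
  have hρ3 : ∀ ξ ∈ E, AscLt (pred E μ) ξ → ξ = ρ ∨ AscLt ρ ξ := by
    intro ξ hξ hlt
    rcases htri ξ hξ ρ hρ with h | h | h
    · rcases hp3 ξ hξ (hmin ξ hξ h) with h' | h'
      · exact absurd (h' ▸ hlt) (AscLt.irrefl _)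
      · exact absurd (hlt.trans h') (AscLt.irrefl _)
    · exact Or.inl h
    · exact Or.inr h
  have hs : ∃ ν, ν ∈ E ∧ AscLt (pred E μ) ν ∧ ∀ ξ ∈ E, AscLt (pred E μ) ξ → ξ = ν ∨ AscLt ν ξ :=
    ⟨ρ, hρ, hρ2, hρ3⟩
  obtain ⟨hs1, hs2, hs3⟩ := Classical.epsilon_spec hs
  change bar E μ ∈ E at hs1
  change AscLt (pred E μ) (bar E μ) at hs2
  change ∀ ξ ∈ E, AscLt (pred E μ) ξ → ξ = bar E μ ∨ AscLt (bar E μ) ξ at hs3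
  rcases hρ3 _ hs1 hs2 with h | h
  · exact h
  · rcases hs3 ρ hρ hρ2 with h' | h'
    · exact h'.symm
    · exact absurd (h.trans h') (AscLt.irrefl _)

theorem finite_bounded (n B : ℕ) :
    {ν : Coeff | (∀ k, ν k ≤ B) ∧ ∀ k, n ≤ k → ν k = 0}.Finite := by
  refine (Set.finite_range fun f : Fin n → Fin (B + 1) => fun k : ℕ =>
    if h : k < n then (f ⟨k, h⟩ : ℕ) else 0).subset ?_
  rintro ν ⟨h1, h2⟩
  refine ⟨fun k => ⟨ν k, Nat.lt_succ_of_le (h1 k)⟩, ?_⟩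
  funext k
  by_cases hk : k < n
  · simp [hk]
  · simp [hk, h2 k (not_lt.1 hk)]

theorem collection_finite_support (hμ : μ ∈ collection L) : ∃ n, ∀ k, n ≤ k → μ k = 0 := by
  obtain ⟨s, ζ, a, c, hblk, -, rfl⟩ := hμ
  refine ⟨∑ i, c i, fun k hk => ?_⟩
  rw [Finset.sum_apply]
  refine Finset.sum_eq_zero fun j _ => (hblk j).eq_zero fun h => ?_
  have := Finset.single_le_sum (f := c) (fun _ _ => Nat.zero_le _) (Finset.mem_univ j)
  have := h.2
  omega

theorem app_zero_apply_of_ge (n : ℕ) (ε : Coeff) (k : ℕ) (hk : n ≤ k) : app n ε 0 k = 0 :=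
  if_neg (not_lt.2 hk)

theorem rev_app_zero (n : ℕ) (ε : Coeff) : rev n (app n ε 0) = rev n ε := by
  rw [← rev_rev, rev_rev_of_zero fun k hk => rev_of_ge hk]

/-- Reversal exchanges the two orders on sequences supported below `n`, so rounding up in the
collection is rounding up among accepted sequences. -/
theorem bar_rev (hb : 0 < periodic L 0) {B : ℕ} (hB : ∀ k, periodic L k ≤ B)
    (hρ : ρ ∈ Adm (periodic L) 0) (hε : app n ε 0 ≠ 0)
    (h1 : DescLe (app n ε 0) (app n ρ 0))
    (h2 : ∀ α ∈ Adm (periodic L) 0, DescLt α (app n ρ 0) → DescLt α (app n ε 0)) :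
    bar (collection L) (rev n ε) = rev n ρ := by
  have hz : ∀ ε : Coeff, ∀ k, n ≤ k → rev n ε k = 0 := fun ε k hk => rev_of_ge hk
  refine bar_eq ?_ ⟨0, ?_, ?_⟩ ?_ (rev_mem_collection hρ n) ?_ ?_
  · refine (finite_bounded n B).subset ?_
    rintro ν ⟨hν, hlt⟩
    have hνz := hlt.zero_of_ge (hz ε)
    refine ⟨fun k => ?_, hνz⟩
    by_cases hk : k < n
    · have := adm_bounded hB (rev_mem_Adm hb hν hνz) (n - 1 - k)
      rwa [rev_of_lt (by omega), show n - 1 - (n - 1 - k) = k by omega] at this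
    · rw [hνz k (not_lt.1 hk)]
      exact Nat.zero_le _
  · have := rev_mem_collection (zero_mem_Adm (periodic L) 0) 0
    convert this using 1
    funext k
    simp [rev]
  · have h : DescLt 0 (app n ε 0) := by
      rcases descLt_trichotomy 0 (app n ε 0) with h | h | ⟨k, -, h⟩
      · exact h
      · exact absurd h.symm hε
      · exact absurd h (Nat.not_lt_zero _)
    have := ascLt_rev (app_zero_apply_of_ge n ε) h
    rw [rev_app_zero] at this
    convert this using 1
    funext k
    simp [rev]
  · intro ξ hξ ξ' hξ'
    obtain ⟨m, hm⟩ := collection_finite_support hξ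
    obtain ⟨m', hm'⟩ := collection_finite_support hξ'
    exact ascLt_trichotomy (n := max m m') (fun k hk => hm k (le_of_max_le_left hk))
      fun k hk => hm' k (le_of_max_le_right hk)
  · rcases h1 with h | h
    · left
      rw [← rev_app_zero n ε, h, rev_app_zero]
    · right
      have := ascLt_rev (app_zero_apply_of_ge n ρ) h
      rwa [rev_app_zero, rev_app_zero] at this
  · intro ξ hξ hlt
    have hξz := hlt.zero_of_ge (hz ρ)
    have h3 := descLt_rev (hz ρ) hlt
    rw [rev_rev] at h3
    have h4 := ascLt_rev (app_zero_apply_of_ge n ε) (h2 _ (rev_mem_Adm hb hξ hξz) h3)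
    rwa [rev_app_zero, rev_rev_of_zero hξz] at h4

/-! ### Rounding up to an accepted sequence -/

/-- A sequence that is not accepted can be rounded up to an accepted one, unless it exceeds all of
them.  The result depends only on an initial segment. -/
theorem exists_roundUp (hε : ε ∉ Adm b 0) (hεb : ¬ DescLe b ε) :
    ∃ m, ∃ ρ ∈ Adm b 0, (∀ k, m ≤ k → ρ k = 0) ∧ ∀ ζ : Coeff, (∀ k < m, ζ k = ε k) →
      DescLt ζ ρ ∧ ∀ α ∈ Adm b 0, DescLe ζ α → DescLe ρ α := by
  classical
  have hex : ∃ m, b (st b 0 ε m) < ε m := by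
    by_contra hcon
    push Not at hcon
    exact hε hcon
  set m := Nat.find hex with hm
  have hm1 : b (st b 0 ε m) < ε m := Nat.find_spec hex
  have hm2 : ∀ k < m, ε k ≤ b (st b 0 ε k) := fun k hk => not_lt.1 (Nat.find_min hex hk)
  -- `m` is the first violation and `j` the last reset before it. Without any such reset `ε` would
  -- copy `b` and then exceed it, contrary to `hεb`.
  obtain ⟨j, hjm, hj, hj'⟩ : ∃ j < m, ε j < b (st b 0 ε j) ∧
      ∀ k, j < k → k < m → ¬ ε k < b (st b 0 ε k) := by
    set D := (Finset.range m).filter fun k => ε k < b (st b 0 ε k) with hD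
    by_cases hDe : D.Nonempty
    · have h1 := D.max'_mem hDe
      have h2 := D.le_max'
      simp only [hD, Finset.mem_filter, Finset.mem_range] at h1 h2
      refine ⟨_, h1.1, h1.2, fun k hk hkm hlt => ?_⟩
      exact absurd (h2 k ⟨hkm, hlt⟩) (not_le.2 hk)
    · exfalso
      have h1 : ∀ k < m, ¬ ε k < b (st b 0 ε k) := fun k hk hlt =>
        hDe ⟨k, by simp only [hD, Finset.mem_filter, Finset.mem_range]; exact ⟨hk, hlt⟩⟩
      have h2 : ∀ k ≤ m, st b 0 ε k = k := fun k hk => by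
        rw [st_eq_of_forall_not_lt fun l hl => h1 l (by omega), zero_add]
      refine hεb (Or.inr ⟨m, fun k hk => ?_, ?_⟩)
      · have h3 := h1 k hk
        have h4 := hm2 k hk
        rw [h2 k hk.le] at h3 h4
        omega
      · rwa [h2 m le_rfl] at hm1
  -- Between `j` and `m` all digits are already maximal, so position `j` is the last place where `ε`
  -- can be raised.
  let ρ : Coeff := fun k => if k < j then ε k else if k = j then ε j + 1 else 0
  have hρ1 : ∀ k < j, ρ k = ε k := fun k hk => if_pos hk
  have hρ2 : ρ j = ε j + 1 := by simp [ρ]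
  have hρ3 : ∀ k, j < k → ρ k = 0 := fun k hk => by
    simp only [ρ]
    rw [if_neg (by omega), if_neg (by omega)]
  refine ⟨m + 1, ρ, fun k => ?_, fun k hk => hρ3 k (by omega), fun ζ hζ => ⟨⟨j, fun k hk => ?_, ?_⟩,
    fun α hα h => ?_⟩⟩
  · rcases lt_trichotomy k j with hk | rfl | hk
    · rw [hρ1 k hk, st_congr fun l hl => hρ1 l (by omega)]
      exact hm2 k (by omega)
    · rw [hρ2, st_congr hρ1]
      exact hj
    · rw [hρ3 k hk]
      exact Nat.zero_le _
  · rw [hζ k (by omega), hρ1 k hk]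
  · rw [hζ j (by omega), hρ2]
    exact Nat.lt_succ_self _
  · have hnot : ¬ ∀ k < m, α k = ε k := by
      intro hagree
      have h1 := hα m
      rw [st_congr hagree] at h1
      rcases h with rfl | ⟨l, hl, hlt⟩
      · rw [hζ m (by omega)] at h1
        omega
      · rcases lt_trichotomy l m with hlm | rfl | hlm
        · rw [hζ l (by omega), hagree l hlm] at hlt
          omega
        · rw [hζ _ (by omega)] at hlt
          omega
        · rw [← hl m hlm, hζ m (by omega)] at h1
          omega
    rcases h with rfl | ⟨l, hl, hlt⟩
    · exact absurd (fun k hk => hζ k (by omega)) hnot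
    have hlm : l < m := by
      by_contra hcon
      exact hnot fun k hk => by rw [← hl k (by omega), hζ k (by omega)]
    rw [hζ l (by omega)] at hlt
    have hl' : ∀ k < l, α k = ε k := fun k hk => by rw [← hl k hk, hζ k (by omega)]
    rcases lt_trichotomy l j with hlj | rfl | hlj
    · exact Or.inr ⟨l, fun k hk => by rw [hρ1 k (by omega), hl' k hk], by rwa [hρ1 l hlj]⟩
    · rw [← not_descLt]
      rintro ⟨k, hk, hlt'⟩
      rcases lt_trichotomy k l with hkl | rfl | hkl
      · rw [hl' k hkl, hρ1 k hkl] at hlt'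
        exact lt_irrefl _ hlt'
      · rw [hρ2] at hlt'
        omega
      · rw [hρ3 k hkl] at hlt'
        omega
    · have h1 := hα l
      rw [st_congr hl'] at h1
      exact absurd (hlt.trans_le h1) (hj' l hlj hlm)

/-! ### The map `revBar` as rounding up. -/

theorem maxStar_zero (L : List ℕ) : maxStar L 0 = periodic L := by
  funext k
  rw [maxStar_of_le (Nat.zero_le k), Nat.sub_zero]

theorem tendsto_rev_rev (ρ : Coeff) :
    Tendsto (fun n : ℕ => rev n (rev n ρ)) atTop (nhds ρ) := by
  rw [tendsto_pi_nhds]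
  intro k
  refine tendsto_const_nhds.congr' ?_
  filter_upwards [eventually_gt_atTop k] with n hn
  rw [rev_rev, app_of_lt hn]

/-- `revBar L ε` is the smallest accepted sequence that is at least `ε`, if there is one. -/
theorem revBar_spec (hb : 0 < periodic L 0) {B : ℕ} (hB : ∀ k, periodic L k ≤ B) (hε : ε ≠ 0) :
    revBar L ε ∈ Adm (periodic L) 0 ∧
      (∀ α ∈ Adm (periodic L) 0, DescLe ε α → DescLe (revBar L ε) α) ∧
      (DescLe ε (revBar L ε) ∨ revBar L ε = periodic L) := by
  by_cases hbig : DescLe (periodic L) ε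
  · have h1 : revBar L ε = periodic L := by
      rw [revBar, maxStar_zero]
      exact if_pos hbig
    rw [h1]
    exact ⟨self_mem_Adm _, fun α _ h => hbig.trans h, Or.inr rfl⟩
  obtain ⟨j, hj⟩ := Function.ne_iff.1 hε
  have hne : ∀ n, j < n → app n ε 0 ≠ 0 := fun n hn h => by
    have := congrFun h j
    rw [app_of_lt hn] at this
    exact hj this
  have key : ∀ ρ : Coeff, (∀ᶠ n in atTop, bar (collection L) (rev n ε) = rev n ρ) →
      revBar L ε = ρ := by
    intro ρ hρ
    rw [revBar, maxStar_zero]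
    refine (if_neg hbig).trans (Tendsto.limUnder_eq ((tendsto_rev_rev ρ).congr' ?_))
    filter_upwards [hρ] with n hn
    rw [hn]
  by_cases hadm : ε ∈ Adm (periodic L) 0
  · have h1 : revBar L ε = ε := by
      refine key ε ?_
      filter_upwards [eventually_gt_atTop j] with n hn
      exact bar_rev hb hB hadm (hne n hn) (DescLe.refl _) fun α _ h => h
    rw [h1]
    exact ⟨hadm, fun α _ h => h, Or.inl (DescLe.refl _)⟩
  · obtain ⟨m, ρ, hρ, hρm, hround⟩ := exists_roundUp hadm hbig
    have h1 : revBar L ε = ρ := by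
      refine key ρ ?_
      -- Rounding up depends only on the first `m` digits, so all long enough truncations of `ε`
      -- round to the same `ρ`.
      filter_upwards [eventually_gt_atTop j, eventually_ge_atTop m] with n hn hmn
      have h2 : app n ρ 0 = ρ := app_zero_of_zero fun k hk => hρm k (hmn.trans hk)
      have h3 := hround (app n ε 0) fun k hk => app_of_lt (by omega)
      refine bar_rev hb hB hρ (hne n hn) ?_ fun α hα h => ?_
      · rw [h2]
        exact Or.inr h3.1
      · rw [h2] at h
        rw [← not_descLe] at h ⊢
        exact fun h' => h (h3.2 α hα h')
    rw [h1]
    have h3 := hround ε fun _ _ => rfl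
    exact ⟨hρ, h3.2, Or.inl (Or.inr h3.1)⟩

end GenZeck

namespace GenZeck
variable {b b' : Coeff} {i n : ℕ} {ε ζ ξ α η : Coeff} {w w' : ℝ} {L L' : List ℕ}

/-! ### Shifts -/

theorem shift_mem_Adm (hb : 0 < b 0) (hε : ε ∈ Adm b 0) (n : ℕ) : app n 0 ε ∈ Adm b 0 :=
  adm_app (fun _ _ => Nat.zero_le _) (by rwa [st_eq_zero_of_zeros (ε := 0) hb fun _ _ => rfl])

theorem psum_eq_zero (h : ∀ k < n, ε k = 0) : psum w ε n = 0 :=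
  Finset.sum_eq_zero fun k hk => by simp [h k (Finset.mem_range.1 hk)]

theorem IsBase.eval_eq_of_zeros (H : IsBase b w) (hε : ε ∈ Adm b i) (h : ∀ k < n, ε k = 0) :
    eval w ε = w ^ n * eval w (tl n ε) := by
  rw [H.eval_split hε n, psum_eq_zero h, zero_add]

theorem IsBase.eval_pos (H : IsBase b w) (hε : ε ∈ Adm b i) (h0 : ε ≠ 0) : 0 < eval w ε := by
  obtain ⟨B, hB⟩ := H.bdd
  exact GenZeck.eval_pos H.pos H.lt_one (adm_bounded hB hε) h0

theorem IsBase.zeros_of_eval_lt (H : IsBase b w) (hε : ε ∈ Adm b i) (h : eval w ε < w ^ n)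
    (k : ℕ) (hk : k < n) : ε k = 0 := by
  have hw := H.pos
  by_contra hne
  have h1 : (1 : ℝ) ≤ ε k := by exact_mod_cast Nat.pos_of_ne_zero hne
  have h2 := (H.summable hε).le_tsum k fun j _ => by positivity
  have h3 : w ^ n ≤ w ^ (k + 1) := pow_le_pow_of_le_one hw.le H.lt_one.le hk
  have h4 : 1 * w ^ (k + 1) ≤ ε k * w ^ (k + 1) := by gcongr
  rw [eval] at h
  linarith

theorem exists_eval_eq_base (H : IsBase b w) (w' : ℝ) : ∃ ε ∈ Adm b 0, eval w' ε = w' := by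
  let one : Coeff := fun k => if k = 0 then 1 else 0
  have h0 : one 0 = 1 := rfl
  have h1 : ∀ k, k ≠ 0 → one k = 0 := fun k hk => if_neg hk
  refine ⟨one, fun k => ?_, ?_⟩
  · rcases Nat.eq_zero_or_pos k with rfl | hk
    · rw [h0]
      exact H.head
    · rw [h1 k hk.ne']
      exact Nat.zero_le _
  · rw [eval, tsum_eq_single 0 fun k hk => by rw [h1 k hk]; simp]
    simp [h0]

/-! ### Comparison of two bases -/

/-- Two digit bounds the first of which accepts fewer sequences. -/
structure IsPair (b b' : Coeff) (w w' : ℝ) : Prop where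
  left : IsBase b w
  right : IsBase b' w'
  subset : Adm b 0 ⊆ Adm b' 0
  ne : b ≠ b'

namespace IsPair
variable (P : IsPair b b' w w')
include P

/-- The value `1` would require `α` to have no reset relative to `b'`, that is `α = b'`; then `b ≤
b' = α ≤ b` contradicts `b ≠ b'`. -/
theorem eval_lt_one (hα : α ∈ Adm b 0) : eval w' α < 1 := by
  have hα' := P.subset hα
  by_cases h : ∃ k, α k < b' (st b' 0 α k)
  · obtain ⟨k, hk⟩ := h
    rw [← P.right.eval_tl_zero]
    exact P.right.eval_lt_tl hα' hk
  · push Not at h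
    have h1 := adm_eq_tl hα' fun k => not_lt.2 (h k)
    rw [tl_zero] at h1
    have h2 := adm_descLe hα
    have h3 := adm_descLe (P.subset (self_mem_Adm b))
    rw [h1] at h2
    exact absurd (h3.antisymm h2) P.ne

theorem eval_mem_Ioo (hα : α ∈ Adm b 0) (h0 : α ≠ 0) : eval w' α ∈ Ioo (0 : ℝ) 1 :=
  ⟨P.right.eval_pos (P.subset hα) h0, P.eval_lt_one hα⟩

/-- The sequence `b` has value `1` in base `w` but value less than `1` in base `w'`. -/
theorem base_lt : w' < w := by
  by_contra hcon
  have hw := P.left.pos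
  have h1 := P.eval_lt_one (self_mem_Adm b)
  have h2 : eval w b ≤ eval w' b := by
    refine Summable.tsum_le_tsum (fun k => ?_) (P.left.summable (self_mem_Adm b))
      (P.right.summable (P.subset (self_mem_Adm b)))
    have := not_lt.1 hcon
    gcongr
  rw [P.left.eval_self] at h2
  linarith

/-- Arbitrarily close to an accepted sequence there is one of sufficiently different value. -/
theorem exists_near : ∃ c > 0, ∃ D, ∀ α ∈ Adm b 0, ∀ n, ∃ β ∈ Adm b 0, (∀ k < n, β k = α k) ∧
    c * w ^ n ≤ |eval w β - eval w α| ∧ |eval w' β - eval w' α| ≤ D * w' ^ n := by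
  obtain ⟨c, hc, hT⟩ := P.left.tail
  obtain ⟨B, hB⟩ := P.right.bdd
  have hw := P.left.pos
  have hw' := P.right.pos
  refine ⟨c / 2, by positivity, B * w' / (1 - w'), fun α hα n => ?_⟩
  obtain ⟨β, hβ, hβα, hβe⟩ : ∃ β ∈ Adm b 0, (∀ k < n, β k = α k) ∧
      c / 2 * w ^ n ≤ |eval w β - eval w α| := by
    -- The smallest and the largest continuation after `n` digits differ in value by at least `c * w
    -- ^ n`, so one of them is at least half of that away from `α`.
    have h0 := adm_app (fun k _ => hα k) (zero_mem_Adm b (st b 0 α n))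
    have h1 := adm_app (fun k _ => hα k) (tl_mem_Adm b (st b 0 α n))
    have e0 := P.left.eval_split h0 n
    have e1 := P.left.eval_split h1 n
    rw [tl_app, psum_congr fun k hk => app_of_lt hk] at e0 e1
    rw [eval_zero, mul_zero, add_zero] at e0
    have h2 := hT (st b 0 α n)
    have h3 : w ^ n * c ≤ w ^ n * eval w (tl (st b 0 α n) b) := by gcongr
    by_cases h : c / 2 * w ^ n ≤ |eval w (app n α 0) - eval w α|
    · exact ⟨_, h0, fun k hk => app_of_lt hk, h⟩
    · refine ⟨_, h1, fun k hk => app_of_lt hk, ?_⟩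
      have h4 := abs_lt.1 (not_le.1 h)
      refine le_trans ?_ (le_abs_self _)
      linarith [h4.1, h4.2]
  refine ⟨β, hβ, hβα, hβe, ?_⟩
  rw [P.right.eval_split (P.subset hβ) n, P.right.eval_split (P.subset hα) n, psum_congr hβα,
    add_sub_add_left_eq_sub, ← mul_sub, abs_mul, abs_of_pos (pow_pos hw' n), mul_comm]
  refine mul_le_mul_of_nonneg_right ?_ (by positivity)
  have b1 := eval_le hw' P.right.lt_one (adm_bounded hB (adm_tl (P.subset hβ) n))
  have b2 := eval_le hw' P.right.lt_one (adm_bounded hB (adm_tl (P.subset hα) n))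
  have b3 := eval_nonneg (ε := tl n β) hw'
  have b4 := eval_nonneg (ε := tl n α) hw'
  rw [abs_le]
  constructor <;> linarith

/-- A function that transports the values of accepted sequences from the second base to the first
one is not differentiable at these values. -/
theorem not_differentiableAt {f : ℝ → ℝ}
    (hf : ∀ α ∈ Adm b 0, α ≠ 0 → f (eval w' α) = eval w α) (hα : α ∈ Adm b 0) (h0 : α ≠ 0) :
    ¬ DifferentiableAt ℝ f (eval w' α) := by
  intro hd
  have hw := P.left.pos
  have hw' := P.right.pos
  obtain ⟨c, hc, D, hD⟩ := P.exists_near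
  choose β hβ hβα hβe hβe' using hD α hα
  obtain ⟨j, hj⟩ := Function.ne_iff.1 h0
  have hz : Tendsto (fun n => eval w' (β n)) atTop (nhds (eval w' α)) := by
    rw [tendsto_iff_norm_sub_tendsto_zero]
    have h1 : Tendsto (fun n => D * w' ^ n) atTop (nhds 0) := by
      simpa using (tendsto_pow_atTop_nhds_zero_of_lt_one hw'.le P.right.lt_one).const_mul D
    exact squeeze_zero (fun n => norm_nonneg _) hβe' h1
  -- Differentiability would give a local Lipschitz bound at the point, hence `c * w ^ n ≤ |C| * D *
  -- w' ^ n` for large `n`, which fails since `w' < w`.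
  obtain ⟨C, hC⟩ := (hd.hasDerivAt.hasFDerivAt.isBigO_sub.comp_tendsto hz).bound
  have h2 : Tendsto (fun n => |C| * D * (w' / w) ^ n) atTop (nhds 0) := by
    simpa using (tendsto_pow_atTop_nhds_zero_of_lt_one (by positivity)
      ((div_lt_one hw).2 P.base_lt)).const_mul (|C| * D)
  obtain ⟨n, h3, h4, h5⟩ := (hC.and ((eventually_gt_atTop j).and
    (h2.eventually (gt_mem_nhds hc)))).exists
  have hne : β n ≠ 0 := fun h => hj (by rw [← hβα n j h4, h])
  simp only [Function.comp_apply, Real.norm_eq_abs] at h3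
  rw [hf _ (hβ n) hne, hf _ hα h0] at h3
  have h6 : c * w ^ n ≤ |C| * (D * w' ^ n) := by
    refine (hβe n).trans (h3.trans ?_)
    calc C * |eval w' (β n) - eval w' α| ≤ |C| * |eval w' (β n) - eval w' α| := by
          gcongr
          exact le_abs_self C
      _ ≤ _ := by gcongr; exact hβe' n
  rw [div_pow] at h5
  have h7 : |C| * D * (w' ^ n / w ^ n) * w ^ n < c * w ^ n :=
    mul_lt_mul_of_pos_right h5 (pow_pos hw n)
  have h8 : |C| * D * (w' ^ n / w ^ n) * w ^ n = |C| * (D * w' ^ n) := by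
    field_simp
  linarith

end IsPair

/-! ### Values of the rounded sequences -/

theorem eval_revBar_eq (P : IsPair (periodic L) b' w w') (hα : α ∈ Adm (periodic L) 0)
    (hη : η ∈ Adm b' 0) (hη0 : η ≠ 0) (hinf : ∀ m, ∃ n ≥ m, η n < b' (st b' 0 η n))
    (h : eval w' η = eval w' α) : eval w (revBar L η) = eval w α := by
  obtain ⟨B, hB⟩ := P.left.bdd
  obtain ⟨h1, h2, h3⟩ := revBar_spec P.left.head hB hη0
  -- With infinitely many resets, `η` is the largest accepted sequence of its value.
  have hle : DescLe α η := by
    rw [← not_descLt]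
    intro hlt
    exact absurd h (P.right.eval_strictMono hη (P.subset hα) hinf hlt).ne
  have hle' : DescLe α (revBar L η) := by
    rcases h3 with h3 | h3
    · exact hle.trans h3
    · rw [h3]
      exact adm_descLe hα
  refine le_antisymm ?_ (P.left.eval_mono hα h1 hle')
  rcases hle with rfl | hlt
  · exact P.left.eval_mono h1 hα (h2 _ hα (DescLe.refl _))
  by_contra hcon
  push Not at hcon
  -- If rounding up increased the `w`-value, an intermediate value would yield an accepted `ξ`
  -- strictly between `α` and `revBar L η`. It would lie below `η`, making three sequences `α`, `ξ`,
  -- `η` whose outer two have equal `w'`-value.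
  obtain ⟨v, hv1, hv2⟩ := exists_between hcon
  obtain ⟨ξ, hξ, -, hξv⟩ := P.left.exists_eval_eq ((eval_nonneg P.left.pos).trans hv1.le)
    (hv2.trans_le (P.left.eval_le_one h1))
  have hαξ := P.left.descLt_of_eval_lt hα hξ (hξv ▸ hv1)
  have hξρ := P.left.descLt_of_eval_lt hξ h1 (hξv ▸ hv2)
  have hξη : DescLt ξ η := by
    rw [← not_descLe] at hξρ ⊢
    exact fun h => hξρ (h2 ξ hξ h)
  exact (P.right.eval_lt_of_descLt_of_descLt (P.subset hα) (P.subset hξ) hη hαξ hξη).ne h.symm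

/-- An accepted upper bound of `ζ` has value above `u`, hence at least `v` as the gap contains no
accepted value; so it also bounds `η`. -/
theorem descLe_revBar_of_gap (P : IsPair (periodic L) b' w w') {u v : ℝ}
    (hgap : ∀ α ∈ Adm (periodic L) 0, eval w' α ∉ Ioo u v) (hη : η ∈ Adm b' 0) (hη0 : η ≠ 0)
    (hζ : ζ ∈ Adm b' 0) (hζ0 : ζ ≠ 0) (h : eval w' η ∈ Ioo u v) (h' : eval w' ζ ∈ Ioo u v) :
    DescLe (revBar L η) (revBar L ζ) := by
  obtain ⟨B, hB⟩ := P.left.bdd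
  obtain ⟨h1, h2, h3⟩ := revBar_spec P.left.head hB hη0
  obtain ⟨h1', h2', h3'⟩ := revBar_spec P.left.head hB hζ0
  rcases h3' with h3' | h3'
  · refine h2 _ h1' ?_
    have h4 := P.right.eval_mono hζ (P.subset h1') h3'
    have h5 : v ≤ eval w' (revBar L ζ) := by
      by_contra hcon
      exact hgap _ h1' ⟨h'.1.trans_le h4, not_le.1 hcon⟩
    exact Or.inr (P.right.descLt_of_eval_lt hη (P.subset h1') (h.2.trans_le h5))
  · rw [h3']
    exact adm_descLe h1

theorem revBar_eq_of_gap (P : IsPair (periodic L) b' w w') {u v : ℝ}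
    (hgap : ∀ α ∈ Adm (periodic L) 0, eval w' α ∉ Ioo u v) (hη : η ∈ Adm b' 0) (hη0 : η ≠ 0)
    (hζ : ζ ∈ Adm b' 0) (hζ0 : ζ ≠ 0) (h : eval w' η ∈ Ioo u v) (h' : eval w' ζ ∈ Ioo u v) :
    revBar L η = revBar L ζ :=
  (descLe_revBar_of_gap P hgap hη hη0 hζ hζ0 h h').antisymm
    (descLe_revBar_of_gap P hgap hζ hζ0 hη hη0 h' h)

end GenZeck

namespace GenZeck
variable {b b' : Coeff} {i n : ℕ} {ε ζ ξ α η : Coeff} {w w' : ℝ} {L L' : List ℕ}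

/-! ### From nested collections to a pair of bases. -/

theorem collection_congr (h : periodic L = periodic L') : collection L = collection L' := by
  simp only [collection, IsBlock, IsProperBlock, h]

/-- Acceptance is tested on initial segments, and their reversals are members of the collections. -/
theorem Adm_subset_of_collection_subset (hb : 0 < periodic L' 0)
    (h : collection L ⊆ collection L') : Adm (periodic L) 0 ⊆ Adm (periodic L') 0 := by
  intro ε hε n
  have h1 := rev_mem_Adm hb (h (rev_mem_collection hε (n + 1))) fun k hk => rev_of_ge hk
  rw [rev_rev] at h1
  have h2 := h1 n
  rwa [app_of_lt (Nat.lt_succ_self n), st_app_of_le (Nat.le_succ n)] at h2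

theorem isPair_of_collection_ssubset (hL : 2 ≤ L.length) (hL0 : L.getD 0 0 ≠ 0)
    (hL' : 2 ≤ L'.length) (hL'0 : L'.getD 0 0 ≠ 0) (h : collection L ⊂ collection L') :
    IsPair (periodic L) (periodic L') (omega L) (omega L') where
  left := isBase_periodic hL hL0
  right := isBase_periodic hL' hL'0
  subset := Adm_subset_of_collection_subset (isBase_periodic hL' hL'0).head h.subset
  ne := fun heq => h.ne (collection_congr heq)

/-! ### The function `δ*` -/

section
variable (P : IsPair (periodic L) (periodic L') (omega L) (omega L'))
include P

theorem omega_rpow_gamma : omega L' ^ gamma L L' = omega L := by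
  have hw := P.left.pos
  have hw' := P.right.pos
  have h1 : (1 : ℝ) < (omega L')⁻¹ := (one_lt_inv₀ hw').2 P.right.lt_one
  have h2 := Real.rpow_logb (by positivity) h1.ne' (inv_pos.2 hw)
  rw [Real.inv_rpow hw'.le] at h2
  exact inv_injective h2

theorem deltaOne_eq {y : ℝ} (h0 : 0 < y) (h1 : y < 1) :
    ∃ η ∈ starCollection L', eval (omega L') η = y ∧
      deltaOne L L' y = eval (omega L) (revBar L η) / y ^ gamma L L' := by
  have hex : ∃ ε ∈ starCollection L', eval (omega L') ε = y := by
    obtain ⟨η, hη, hinf, hy⟩ := P.right.exists_eval_eq h0.le h1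
    refine ⟨η, (mem_starCollection_iff P.right.head).2 ⟨hη, ?_, hinf⟩, hy⟩
    rintro rfl
    rw [eval_zero] at hy
    exact h0.ne hy
  refine ⟨hex.choose, hex.choose_spec.1, hex.choose_spec.2, ?_⟩
  rw [deltaOne, dif_pos hex]

theorem exists_scale {y : ℝ} (h0 : 0 < y) (h1 : y < 1) :
    ∃ m : ℕ, y ∈ Ico (omega L' ^ (m + 1)) (omega L' ^ m) := by
  classical
  have hex : ∃ n : ℕ, omega L' ^ n ≤ y := by
    obtain ⟨n, hn⟩ := exists_pow_lt_of_lt_one h0 P.right.lt_one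
    exact ⟨n, hn.le⟩
  have hspec := Nat.find_spec hex
  have hne : Nat.find hex ≠ 0 := by
    intro h
    rw [h, pow_zero] at hspec
    linarith
  obtain ⟨m, hm⟩ := Nat.exists_eq_succ_of_ne_zero hne
  rw [hm] at hspec
  exact ⟨m, hspec, not_le.1 (Nat.find_min hex (m := m) (by omega))⟩

theorem deltaStar_eq {y : ℝ} {m : ℕ} (hy : y ∈ Ico (omega L' ^ (m + 1)) (omega L' ^ m)) :
    deltaStar L L' y = deltaOne L L' (y / omega L' ^ m) := by
  have hw' := P.right.pos
  have hex : ∃ n : ℕ, 1 ≤ n ∧ y ∈ Ico (omega L' ^ n) (omega L' ^ (n - 1)) :=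
    ⟨m + 1, by omega, hy⟩
  have huniq : hex.choose = m + 1 := by
    obtain ⟨h1, h2, h3⟩ := hex.choose_spec
    have h4 := (pow_lt_pow_iff_right_of_lt_one₀ hw' P.right.lt_one).1 (hy.1.trans_lt h3)
    have h5 := (pow_lt_pow_iff_right_of_lt_one₀ hw' P.right.lt_one).1 (h2.trans_lt hy.2)
    omega
  rw [deltaStar, dif_pos hex, huniq, Nat.add_sub_cancel]

theorem deltaStar_mul_rpow {y : ℝ} {m : ℕ}
    (hy : y ∈ Ico (omega L' ^ (m + 1)) (omega L' ^ m)) :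
    ∃ η ∈ starCollection L', eval (omega L') η = y / omega L' ^ m ∧
      deltaStar L L' y * y ^ gamma L L' = omega L ^ m * eval (omega L) (revBar L η) := by
  have hw := P.left.pos
  have hw' := P.right.pos
  have hpos : 0 < omega L' ^ m := pow_pos hw' m
  have hy0 : 0 < y := (pow_pos hw' _).trans_le hy.1
  obtain ⟨η, hη, he, hd⟩ := deltaOne_eq P (div_pos hy0 hpos) ((div_lt_one hpos).2 hy.2)
  refine ⟨η, hη, he, ?_⟩
  have h1 : (omega L' ^ m) ^ gamma L L' = omega L ^ m := by
    rw [← Real.rpow_natCast, ← Real.rpow_mul hw'.le, mul_comm, Real.rpow_mul hw'.le,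
      omega_rpow_gamma P, Real.rpow_natCast]
  have h2 : 0 < y ^ gamma L L' := Real.rpow_pos_of_pos hy0 _
  have h3 : 0 < omega L ^ m := pow_pos hw m
  rw [deltaStar_eq P hy, hd, Real.div_rpow hy0.le hpos.le, h1]
  field_simp

/-- On the values of accepted sequences, `δ*(y) y ^ γ` is the value in the other base. -/
theorem deltaStar_mul_rpow_eval (hα : α ∈ Adm (periodic L) 0) (h0 : α ≠ 0) :
    deltaStar L L' (eval (omega L') α) * eval (omega L') α ^ gamma L L' =
      eval (omega L) α := by
  have hw' := P.right.pos
  obtain ⟨hy0, hy1⟩ := P.eval_mem_Ioo hα h0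
  obtain ⟨m, hm⟩ := exists_scale P hy0 hy1
  obtain ⟨η, hη, he, hd⟩ := deltaStar_mul_rpow P hm
  obtain ⟨h1, h2, h3⟩ := (mem_starCollection_iff P.right.head).1 hη
  -- A value below `omega L' ^ m` forces `m` leading zeros, so the rescaling in `δ*` is the shift of
  -- `α` by `m`.
  have hz := P.right.zeros_of_eval_lt (P.subset hα) hm.2
  have hα' : tl m α ∈ Adm (periodic L) 0 := by
    have := adm_tl hα m
    rwa [st_eq_zero_of_zeros P.left.head hz] at this
  rw [hd, eval_revBar_eq P hα' h1 h2 h3, ← P.left.eval_eq_of_zeros hα hz]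
  rw [he, P.right.eval_eq_of_zeros (P.subset hα) hz]
  field_simp

theorem eventually_deltaStar_mul_rpow_eq {y : ℝ} (h0 : 0 < y) (h1 : y < 1)
    (hy : y ∉ eval (omega L') '' Adm (periodic L) 0) :
    ∀ᶠ z in nhds y, deltaStar L L' z * z ^ gamma L L' = deltaStar L L' y * y ^ gamma L L' := by
  have hw' := P.right.pos
  obtain ⟨m, hm⟩ := exists_scale P h0 h1
  have hpos : 0 < omega L' ^ m := pow_pos hw' m
  have hshift : ∀ α ∈ Adm (periodic L) 0,
      omega L' ^ m * eval (omega L') α ∈ eval (omega L') '' Adm (periodic L) 0 := fun α hα =>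
    ⟨_, shift_mem_Adm P.left.head hα m,
      by rw [eval_split hw' P.right.lt_one
          (adm_bounded P.left.bdd.choose_spec (shift_mem_Adm P.left.head hα m)) m, tl_app,
          psum_eq_zero fun k hk => app_of_lt hk, zero_add]⟩
  -- The endpoints of the scales are values of shifts of `(1, 0, 0, …)`, hence accepted values. So
  -- `y` is interior to its scale and one `m` serves a whole neighbourhood.
  have hlt : omega L' ^ (m + 1) < y := by
    refine hm.1.lt_of_ne fun heq => hy ?_
    obtain ⟨ε, hε, he⟩ := exists_eval_eq_base P.left (omega L')
    have := hshift ε hε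
    rwa [he, ← pow_succ, heq] at this
  obtain ⟨B, hB⟩ := P.left.bdd
  have hopen : (eval (omega L') '' Adm (periodic L) 0)ᶜ ∩
      Ioo (omega L' ^ (m + 1)) (omega L' ^ m) ∈ nhds y :=
    inter_mem ((isClosed_eval_image hw' P.right.lt_one hB 0).isOpen_compl.mem_nhds hy)
      (Ioo_mem_nhds hlt hm.2)
  obtain ⟨u, v, huv, hsub⟩ := mem_nhds_iff_exists_Ioo_subset.1 hopen
  filter_upwards [Ioo_mem_nhds huv.1 huv.2] with z hz
  obtain ⟨η, hη, he, hd⟩ := deltaStar_mul_rpow P (Ioo_subset_Ico_self (hsub hz).2)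
  obtain ⟨ζ, hζ, he', hd'⟩ := deltaStar_mul_rpow P hm
  obtain ⟨hη1, hη2, -⟩ := (mem_starCollection_iff P.right.head).1 hη
  obtain ⟨hζ1, hζ2, -⟩ := (mem_starCollection_iff P.right.head).1 hζ
  rw [hd, hd', revBar_eq_of_gap P (u := u / omega L' ^ m) (v := v / omega L' ^ m) ?_
    hη1 hη2 hζ1 hζ2 ?_ ?_]
  · intro α hα hmem
    refine (hsub (a := omega L' ^ m * eval (omega L') α) ⟨?_, ?_⟩).1 (hshift α hα)
    · exact (div_lt_iff₀' hpos).1 hmem.1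
    · exact (lt_div_iff₀' hpos).1 hmem.2
  · rw [he]
    exact ⟨div_lt_div_of_pos_right hz.1 hpos, div_lt_div_of_pos_right hz.2 hpos⟩
  · rw [he']
    exact ⟨div_lt_div_of_pos_right huv.1 hpos, div_lt_div_of_pos_right huv.2 hpos⟩

theorem differentiableAt_deltaStar {y : ℝ} (h0 : 0 < y) (h1 : y < 1)
    (hy : y ∉ eval (omega L') '' Adm (periodic L) 0) :
    DifferentiableAt ℝ (deltaStar L L') y := by
  have hpow : DifferentiableAt ℝ (fun z : ℝ => z ^ gamma L L') y :=
    (Real.differentiableAt_rpow_const_of_ne _ h0.ne')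
  have hne : y ^ gamma L L' ≠ 0 := (Real.rpow_pos_of_pos h0 _).ne'
  refine ((differentiableAt_const (deltaStar L L' y * y ^ gamma L L')).div hpow
    hne).congr_of_eventuallyEq ?_
  filter_upwards [eventually_deltaStar_mul_rpow_eq P h0 h1 hy, lt_mem_nhds h0] with z hz hz0
  have := (Real.rpow_pos_of_pos hz0 (gamma L L')).ne'
  simp only [Pi.div_apply]
  rw [← hz]
  field_simp

theorem not_differentiableAt_deltaStar (hα : α ∈ Adm (periodic L) 0) (h0 : α ≠ 0) :
    ¬ DifferentiableAt ℝ (deltaStar L L') (eval (omega L') α) := by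
  intro hd
  have hy := (P.eval_mem_Ioo hα h0).1
  refine P.not_differentiableAt (f := fun z => deltaStar L L' z * z ^ gamma L L')
    (fun β hβ hβ0 => deltaStar_mul_rpow_eval P hβ hβ0) hα h0 ?_
  exact hd.mul (Real.differentiableAt_rpow_const_of_ne _ hy.ne')

/-! ### The points of differentiability and the set `U`. -/

theorem setOf_differentiableAt_deltaStar :
    {x ∈ Ioo (0 : ℝ) 1 | DifferentiableAt ℝ (deltaStar L L') x} =
      Ioo (0 : ℝ) 1 \ eval (omega L') '' starClosure L := by
  ext y
  constructor
  · rintro ⟨hy, hd⟩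
    refine ⟨hy, ?_⟩
    rintro ⟨α, hα, rfl⟩
    obtain ⟨h1, h2⟩ := (mem_starClosure_iff P.left.head).1 hα
    exact not_differentiableAt_deltaStar P h1 h2 hd
  · rintro ⟨hy, hn⟩
    refine ⟨hy, differentiableAt_deltaStar P hy.1 hy.2 ?_⟩
    rintro ⟨α, hα, rfl⟩
    refine hn ⟨α, (mem_starClosure_iff P.left.head).2 ⟨hα, ?_⟩, rfl⟩
    rintro rfl
    rw [eval_zero] at hy
    exact lt_irrefl _ hy.1

/-- Infinitely many resets make evaluation strictly monotone. Injectivity lets the image of the set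
difference in `U` be computed as a difference of images. -/
theorem eval_injOn_starCollection : InjOn (eval (omega L')) (starCollection L') := by
  intro ε hε ζ hζ h
  obtain ⟨h1, -, h2⟩ := (mem_starCollection_iff P.right.head).1 hε
  obtain ⟨h3, -, h4⟩ := (mem_starCollection_iff P.right.head).1 hζ
  rcases descLt_trichotomy ε ζ with hlt | heq | hlt
  · exact absurd h (P.right.eval_strictMono h1 h3 h2 hlt).ne
  · exact heq
  · exact absurd h.symm (P.right.eval_strictMono h3 h1 h4 hlt).ne

theorem eval_image_starCollection :
    eval (omega L') '' starCollection L' = Ioo (0 : ℝ) 1 := by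
  ext y
  constructor
  · rintro ⟨ε, hε, rfl⟩
    obtain ⟨h1, h2, h3⟩ := (mem_starCollection_iff P.right.head).1 hε
    refine ⟨P.right.eval_pos h1 h2, ?_⟩
    obtain ⟨n, -, hn⟩ := h3 0
    rw [← P.right.eval_tl_zero]
    exact P.right.eval_lt_tl h1 hn
  · rintro ⟨h0, h1⟩
    obtain ⟨η, hη, he, -⟩ := deltaOne_eq P h0 h1
    exact ⟨η, hη, he⟩

theorem U_eq (h : starClosure L ⊆ starCollection L') :
    U L L' = Ioo (0 : ℝ) 1 \ eval (omega L') '' starClosure L := by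
  rw [U, (eval_injOn_starCollection P).image_sdiff_subset h, eval_image_starCollection P]

end
end GenZeck

theorem mainTheorem4 (L L' : List ℕ)
    (hL : 2 ≤ L.length) (hL0 : L.getD 0 0 ≠ 0)
    (hL' : 2 ≤ L'.length) (hL'0 : L'.getD 0 0 ≠ 0)
    (hsub : GenZeck.collection L ⊂ GenZeck.collection L') :
    (∀ ε ∈ GenZeck.starClosure L,
      GenZeck.eval (GenZeck.omega L') ε ∈ Set.Ioo (0 : ℝ) 1 ∧
      ¬ DifferentiableAt ℝ (GenZeck.deltaStar L L') (GenZeck.eval (GenZeck.omega L') ε)) ∧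
    {x ∈ Set.Ioo (0 : ℝ) 1 | DifferentiableAt ℝ (GenZeck.deltaStar L L') x} =
      Set.Ioo (0 : ℝ) 1 \ GenZeck.eval (GenZeck.omega L') '' GenZeck.starClosure L ∧
    (GenZeck.starClosure L ⊆ GenZeck.starCollection L' →
      {x ∈ Set.Ioo (0 : ℝ) 1 | DifferentiableAt ℝ (GenZeck.deltaStar L L') x} =
        GenZeck.U L L') := by
  have P := GenZeck.isPair_of_collection_ssubset hL hL0 hL' hL'0 hsub
  have h := GenZeck.setOf_differentiableAt_deltaStar P
  refine ⟨fun ε hε => ?_, h, fun hU => by rw [h, GenZeck.U_eq P hU]⟩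
  obtain ⟨h1, h2⟩ := (GenZeck.mem_starClosure_iff P.left.head).1 hε
  exact ⟨P.eval_mem_Ioo h1 h2, GenZeck.not_differentiableAt_deltaStar P h1 h2⟩
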